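/- A \emph{Schröder path} of semilength $n$ is a lattice path from $(0,0)$ to $(2n,0)$ with steps $\mathsf u=(1,1)$, $\mathsf d=(1,-1)$, $\mathsf e=(2,0)$ that never goes below the $x$-axis. Let $r_0=1$, $r_n=r_{n-1}+\sum_{k=1}^{n}r_{k-1}r_{n-k}$ be the large Schröder numbers and $B(i)=r_0+\dots+r_{i-2}$ (so $B(1)=0$). For a list $L$ let $L(j)$ be its $j$-th entry, and let $L^i$ be $L$ if $i$ is odd and $L$ reversed if $i$ is even. Define lists $\mathcal S_n$ of paths recursively: $\mathcal S_0$ consists of the empty path, and for $n\ge 1$, with $\bigoplus$ denoting concatenation of lists, $$\mathcal S_n=\bigoplus_{i=1}^{r_{n-1}}\bigl(\mathsf e\,\mathcal S_{n-1}(i)\bigr)\ \oplus\ \bigoplus_{i=1}^{n}\bigoplus_{j=1}^{r_{i-1}}\bigoplus_{k=1}^{r_{n-i}}\Bigl(\mathsf u\,\mathcal S_{i-1}^{\,n+i}(j)\,\mathsf d\,\mathcal S_{n-i}^{\,j+B(i)+1}(k)\Bigr).$$ For a Schröder path $p$ of semilength $n$ define $\varphi(p)\in\mathfrak S_{n+1}$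 as follows (Egge and Mansour). Place a dot at each of the points $(\frac{8m+1}{4},\frac{8a+5}{4})$ and $(\frac{8m+5}{4},\frac{8a+1}{4})$, $0\le a,m<n$, that lies beneath $p$ and above the $x$-axis, and label the dot at $(x,y)$ by $s_i$, where $i=(1+x-y)/2$. As long as some dot has no line through it, take the rightmost such dot (it is unique), with label $s_k$, say, and draw a line from it, to the left and parallel to the $x$-axis, to the leftmost dot that can be reached without crossing $p$, with label $s_l$, say; the $j$-th line drawn gives $\sigma_j=s_ks_{k-1}\cdots s_l$. If $t$ lines are drawn in all, put $\varphi(p)=\sigma_t\cdots\sigma_2\sigma_1(n+1,n,\dots,1)$, where $s_i$ applied to a permutation exchanges its entries in positions $i$ and $i+1$, and products are applied from right to left. Let $\Phi_n=(\varphi(\mathcal S_n(1)),\varphi(\mathcal S_n(2)),\dots)$. The distance $d$ of two permutations is the number of positions in which they differ; the distance $d$ of two paths is the number of positions in which their words differ after each $\mathsf e$ is replaced by $\mathsf r\mathsf r$. Then, for every $n\ge 0$: the list $\mathcal S_n$ has length $r_n$ and contains every Schröder path of semilength $n$ exactly once, and nothing else; $\varphi$ is a bijection from the set of Schröder paths of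 semilength $n$ onto the set $\mathfrak S_{n+1}(1243,2143)$ of permutations of length $n+1$ that avoid the patterns $1243$ and $2143$; the list $\Phi_n$ contains every element of $\mathfrak S_{n+1}(1243,2143)$ exactly once, and nothing else; and for each $1\le q<r_n$, $$d(\mathcal S_n(q),\mathcal S_n(q+1))\le 5\quad\text{and}\quad d(\Phi_n(q),\Phi_n(q+1))\le 5 .$$ Thus $\mathcal S_n$ and $\Phi_n$ are Gray codes with distance $5$ for Schröder paths and Schröder permutations. -/

import Mathlib

namespace SchroderGray

/-! ### Schröder paths -/

/-- The steps `u = (1,1)`, `d = (1,-1)` and `e = (2,0)`. -/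
inductive Step where
  | u
  | d
  | e
  deriving DecidableEq

/-- Horizontal displacement of a step. -/
def Step.width : Step → ℕ
  | .u => 1
  | .d => 1
  | .e => 2

/-- Vertical displacement of a step. -/
def Step.rise : Step → ℤ
  | .u => 1
  | .d => -1
  | .e => 0

/-- A lattice path starting at the origin, given as its word of steps. -/
abbrev Path := List Step

/-- `p` is a Schröder path from `(0,0)` to `(2n,0)`: it never goes below the `x`-axis. -/
def IsSchroderPath (n : ℕ) (p : Path) : Prop :=
  (p.map Step.width).sum = 2 * n ∧
  (p.map Step.rise).sum = 0 ∧
  ∀ q : Path, q <+: p → 0 ≤ (q.map Step.rise).sum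

/-- The alphabet of the words obtained by replacing each `e` by `rr`. -/
inductive UnitStep where
  | u
  | d
  | r
  deriving DecidableEq

/-- A step as a word of steps of width one; `e` becomes `rr`. -/
def Step.expand : Step → List UnitStep
  | .u => [.u]
  | .d => [.d]
  | .e => [.r, .r]

/-- The number of places in which two words differ. -/
def wordDist {α : Type*} [DecidableEq α] (v w : List α) : ℕ :=
  ((Finset.range (max v.length w.length)).filter (fun i => v[i]? ≠ w[i]?)).card

/-- The number of places in which two paths differ when each `e` is replaced by `rr`. -/
def pathDist (p q : Path) : ℕ :=
  wordDist (p.flatMap Step.expand) (q.flatMap Step.expand)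

/-! ### The list of Schröder paths -/

/-- `B(i) = r₀ + ⋯ + r_{i-2}` with `r` the large Schröder numbers; `B(1) = 0`. -/
def B (i : ℕ) : ℕ := ∑ k ∈ Finset.range (i - 1), Nat.largeSchroder k

/-- `L` if `i` is odd, and `L` reversed if `i` is even. -/
def orient {α : Type*} (i : ℕ) (L : List α) : List α :=
  if Odd i then L else L.reverse

/-- The recursively generated list `𝒮ₙ`. In the case `n + 1`, the index `i'` runs through
`0, …, n` and `i = i' + 1`; `zipIdx 1` pairs the entries of a list with the positions
`j = 1, 2, …`. The entries are
`e 𝒮ₙ(k)` for all `k`, followed by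
`u 𝒮_{i-1}^{(n+1)+i}(j) d 𝒮_{(n+1)-i}^{j+B(i)+1}(k)` for all `i`, `j`, `k` in lexicographic
order. -/
def pathList : ℕ → List Path
  | 0 => [[]]
  | n + 1 =>
    (pathList n).map (fun p => Step.e :: p) ++
    (List.finRange (n + 1)).flatMap (fun i' =>
      ((orient ((n + 1) + (i'.val + 1)) (pathList i'.val)).zipIdx 1).flatMap (fun aj =>
        (orient (aj.2 + B (i'.val + 1) + 1) (pathList (n - i'.val))).map (fun b =>
          Step.u :: (aj.1 ++ Step.d :: b))))

/-! ### The Egge–Mansour map -/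

/-- The height of the path above abscissa `x`, for `0 ≤ x ≤` its total width. -/
noncomputable def height : Path → ℝ → ℝ
  | [], _ => 0
  | s :: p, x =>
    if x ≤ s.width then (s.rise / s.width : ℝ) * x
    else (s.rise : ℝ) + height p (x - s.width)

/-- A pair `(X, Y)` stands for the point `(X/4, Y/4)` of the plane. -/
abbrev Dot := ℕ × ℕ

/-- The point of the dot lies beneath the path and above the `x`-axis. -/
def Beneath (p : Path) (P : Dot) : Prop :=
  0 < (P.2 : ℝ) / 4 ∧ (P.2 : ℝ) / 4 < height p ((P.1 : ℝ) / 4)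

open Classical in
/-- The points `((8m+1)/4, (8a+5)/4)` and `((8m+5)/4, (8a+1)/4)`, `0 ≤ a, m < n`, that lie
beneath `p` and above the `x`-axis. -/
noncomputable def dots (n : ℕ) (p : Path) : Finset Dot :=
  ((Finset.range n ×ˢ Finset.range n).image (fun ma => (8 * ma.1 + 1, 8 * ma.2 + 5)) ∪
   (Finset.range n ×ˢ Finset.range n).image (fun ma => (8 * ma.1 + 5, 8 * ma.2 + 1))).filter
    (Beneath p)

/-- The index `i = (1 + x - y) / 2` of the label `s_i` of the dot at `(x, y) = (X/4, Y/4)`;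
the division is exact and `i ≥ 1` for all dots beneath a Schröder path. -/
def label (P : Dot) : ℕ := (4 + P.1 - P.2) / 8

/-- The rightmost dot of `D`. In the procedure below it is unique; the definition takes the
highest of the rightmost ones. -/
def rightmost (D : Finset Dot) : Dot :=
  (D.sup Prod.fst, (D.filter (fun P => P.1 = D.sup Prod.fst)).sup Prod.snd)

/-- The dot `Q` is reached from `P` by a line that runs to the left, parallel to the `x`-axis,
without crossing the path. -/
def Reaches (p : Path) (P Q : Dot) : Prop :=
  Q.2 = P.2 ∧ Q.1 ≤ P.1 ∧
  ∀ z : ℝ, (Q.1 : ℝ) / 4 ≤ z → z ≤ (P.1 : ℝ) / 4 → (P.2 : ℝ) / 4 ≤ height p z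

open Classical in
/-- The dots on the line drawn from `P` to the left (with `P` itself). -/
noncomputable def lineDots (n : ℕ) (p : Path) (P : Dot) : Finset Dot :=
  insert P ((dots n p).filter (Reaches p P))

/-- The leftmost dot on the line drawn from `P`. -/
noncomputable def leftEnd (n : ℕ) (p : Path) (P : Dot) : Dot :=
  ((lineDots n p P).inf' ⟨P, Finset.mem_insert_self _ _⟩ Prod.fst, P.2)

theorem rightmost_mem {D : Finset Dot} (h : D.Nonempty) : rightmost D ∈ D := by
  obtain ⟨P, hP, hPX⟩ := Finset.exists_mem_eq_sup D h Prod.fst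
  have hne : (D.filter (fun P => P.1 = D.sup Prod.fst)).Nonempty :=
    ⟨P, Finset.mem_filter.2 ⟨hP, hPX.symm⟩⟩
  obtain ⟨Q, hQ, hQY⟩ := Finset.exists_mem_eq_sup _ hne Prod.snd
  obtain ⟨hQD, hQX⟩ := Finset.mem_filter.1 hQ
  have hQr : rightmost D = Q := Prod.ext hQX.symm hQY
  rw [hQr]
  exact hQD

/-- The words `σ₁, σ₂, …` in the generators `s_i` obtained when `D` is the set of dots that
have no line yet. The word `s_k s_{k-1} ⋯ s_l` is recorded as `[k, k-1, …, l]`. -/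
noncomputable def lineWords (n : ℕ) (p : Path) (D : Finset Dot) : List (List ℕ) :=
  if h : D.Nonempty then
    let P := rightmost D
    let k := label P
    let l := label (leftEnd n p P)
    (List.range' l (k + 1 - l)).reverse :: lineWords n p (D \ lineDots n p P)
  else []
termination_by D.card
decreasing_by
  have hm : rightmost D ∉ D \ lineDots n p (rightmost D) := fun hm =>
    (Finset.mem_sdiff.1 hm).2 (Finset.mem_insert_self _ _)
  refine Finset.card_lt_card (Finset.ssubset_iff_subset_ne.2 ⟨Finset.sdiff_subset, fun he => ?_⟩)
  exact hm (by rw [he]; exact rightmost_mem h)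

/-- `s_i` applied to `π` exchanges the entries in the (one-based) positions `i` and `i + 1`,
for `1 ≤ i ≤ n`. -/
def applyGen {n : ℕ} (i : ℕ) (π : Equiv.Perm (Fin (n + 1))) : Equiv.Perm (Fin (n + 1)) :=
  if h : i < n + 1 then π * Equiv.swap ⟨i - 1, by omega⟩ ⟨i, h⟩ else π

/-- A word in the generators applied to `π`, its last letter first. -/
def applyWord {n : ℕ} (σ : List ℕ) (π : Equiv.Perm (Fin (n + 1))) :
    Equiv.Perm (Fin (n + 1)) :=
  σ.foldr applyGen π

/-- `φ(p) = σ_j ⋯ σ₂ σ₁ (n+1, n, …, 1)`. -/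
noncomputable def phi (n : ℕ) (p : Path) : Equiv.Perm (Fin (n + 1)) :=
  (lineWords n p (dots n p)).foldl (fun π σ => applyWord σ π) Fin.revPerm

/-- The list `Φₙ = (φ(𝒮ₙ(1)), φ(𝒮ₙ(2)), …)`. -/
noncomputable def permList (n : ℕ) : List (Equiv.Perm (Fin (n + 1))) :=
  (pathList n).map (phi n)

/-! ### Pattern avoidance and Gray codes -/

/-- `π` has a subsequence that is order-isomorphic to `τ`. -/
def ContainsPattern {N k : ℕ} (π : Equiv.Perm (Fin N)) (τ : Fin k → ℕ) : Prop :=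
  ∃ f : Fin k → Fin N, StrictMono f ∧ ∀ a b, π (f a) < π (f b) ↔ τ a < τ b

/-- The set `𝔖_N(1243, 2143)`. -/
def schroderPerms (N : ℕ) : Set (Equiv.Perm (Fin N)) :=
  {π | ¬ ContainsPattern π ![1, 2, 4, 3] ∧ ¬ ContainsPattern π ![2, 1, 4, 3]}

/-- The number of places in which two permutations differ. -/
def permDist {N : ℕ} (σ τ : Equiv.Perm (Fin N)) : ℕ := hammingDist (⇑σ) (⇑τ)

/-- `L` lists every element of `A` exactly once, and nothing else, and consecutive entries
have distance at most `k`. -/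
def IsGrayCode {α : Type*} (dist : α → α → ℕ) (k : ℕ) (A : Set α) (L : List α) : Prop :=
  L.Nodup ∧ (∀ x, x ∈ L ↔ x ∈ A) ∧
  ∀ (q : ℕ) (hq : q + 1 < L.length), dist L[q] L[q + 1] ≤ k

end SchroderGray

/-! Everything follows the first-return decomposition: a Schröder path is empty, `e p`, or `u p d
q`, in exactly one way. Beneath `u p d q`, with `p` of semilength `i`, the dots form three groups:
those of `q`, with labels raised by `i + 1`; a bottom row with labels `1, …, i + 1`; and those of
`p`, with unchanged labels. Their lines are drawn in this order and do not interfere. Hence `φ(p)(x)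
= n - pathPerm n p x` in 0-based positions, where `pathPerm` obeys the recursions `pathPerm_level`
and `pathPerm_arch`.

In `archPerm (i + 1) g f` the value `0` stands at position `i + 1`. Before it stand the entries of
`f` raised by one, with the largest replaced by `i + 1 + g 0`; after it stand the remaining entries
of `g`, raised by `i + 1`. So `i`, `f` and `g` can be read off. Conversely, if an avoiding
permutation has `0` at position `k`, then by pigeonhole at most one earlier entry is at least `k`,
and this forces the same shape (`Avoids.exists_eq_archPerm`). Induction gives the bijection
`phi_bijOn`.

For the Gray codes, `Close` bundles both distance bounds and is inherited when a single part of a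
decomposition changes. The list for `n` begins with `eⁿ` and ends with `u eⁿ⁻¹ d` (`hasEnds`). The
parities in the recursion ensure that at a joint either one part moves to a neighbour and the other
stays, or both parts are such extreme paths, of unchanged type, while `i` grows by one. The latter
case is the explicit computation `close_endPath_succ`. -/

namespace SchroderGray

/-! ### First-return decomposition. -/

/-- Schröder paths by first-return decomposition. -/
inductive Decomposed : ℕ → Path → Prop
  | nil : Decomposed 0 []
  | level {n p} : Decomposed n p → Decomposed (n + 1) (Step.e :: p)
  | arch {i m p q} : Decomposed i p → Decomposed m q →
      Decomposed (i + m + 1) (Step.u :: (p ++ Step.d :: q))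

/-- The total horizontal displacement of a path. -/
def totalWidth (p : Path) : ℕ := (p.map Step.width).sum

/-- The total vertical displacement of a path. -/
def totalRise (p : Path) : ℤ := (p.map Step.rise).sum

@[simp] theorem totalWidth_nil : totalWidth [] = 0 := rfl
@[simp] theorem totalWidth_cons (s : Step) (p : Path) :
    totalWidth (s :: p) = s.width + totalWidth p := by simp [totalWidth]
@[simp] theorem totalWidth_append (p q : Path) :
    totalWidth (p ++ q) = totalWidth p + totalWidth q := by simp [totalWidth]
@[simp] theorem totalRise_nil : totalRise [] = 0 := rfl
@[simp] theorem totalRise_cons (s : Step) (p : Path) :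
    totalRise (s :: p) = s.rise + totalRise p := by simp [totalRise]
@[simp] theorem totalRise_append (p q : Path) :
    totalRise (p ++ q) = totalRise p + totalRise q := by simp [totalRise]

/-- The path `p`, started at height `h`, never goes below the `x`-axis. -/
def StaysAbove (h : ℤ) (p : Path) : Prop := ∀ q : Path, q <+: p → 0 ≤ h + totalRise q

theorem staysAbove_nil {h : ℤ} : StaysAbove h [] ↔ 0 ≤ h := by
  simp [StaysAbove]

theorem staysAbove_cons {h : ℤ} {s : Step} {p : Path} :
    StaysAbove h (s :: p) ↔ 0 ≤ h ∧ StaysAbove (h + s.rise) p := by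
  constructor
  · refine fun H => ⟨by simpa using H [] (List.nil_prefix), fun q hq => ?_⟩
    have := H (s :: q) (List.cons_prefix_cons.2 ⟨rfl, hq⟩)
    simpa [add_assoc] using this
  · rintro ⟨h0, H⟩ q hq
    rcases List.prefix_cons_iff.1 hq with rfl | ⟨t, rfl, ht⟩
    · simpa using h0
    · simpa [add_assoc] using H t ht

theorem StaysAbove.nonneg {h : ℤ} {p : Path} (H : StaysAbove h p) : 0 ≤ h := by
  simpa using H [] (List.nil_prefix)

theorem staysAbove_append {p q : Path} : ∀ {h : ℤ},
    StaysAbove h (p ++ q) ↔ StaysAbove h p ∧ StaysAbove (h + totalRise p) q := by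
  induction p with
  | nil => intro h; simp only [List.nil_append, staysAbove_nil, totalRise_nil, add_zero]
           exact ⟨fun H => ⟨H.nonneg, H⟩, fun H => H.2⟩
  | cons s p ih =>
    intro h
    simp only [List.cons_append, staysAbove_cons, ih, totalRise_cons, and_assoc, add_assoc]

theorem isSchroderPath_iff {n : ℕ} {p : Path} :
    IsSchroderPath n p ↔ totalWidth p = 2 * n ∧ totalRise p = 0 ∧ StaysAbove 0 p := by
  simp [IsSchroderPath, StaysAbove, totalWidth, totalRise]

theorem Decomposed.isSchroderPath {n : ℕ} {p : Path} (h : Decomposed n p) :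
    IsSchroderPath n p := by
  rw [isSchroderPath_iff]
  induction h with
  | nil => simp [staysAbove_nil]
  | level _ ih =>
    obtain ⟨h1, h2, h3⟩ := ih
    refine ⟨?_, ?_, ?_⟩
    · simp [h1, Step.width]; ring
    · simp [h2, Step.rise]
    · simpa [staysAbove_cons, Step.rise] using h3
  | @arch i m p q _ _ ih1 ih2 =>
    obtain ⟨h1, h2, h3⟩ := ih1
    obtain ⟨k1, k2, k3⟩ := ih2
    refine ⟨?_, ?_, ?_⟩
    · simp [h1, k1, Step.width]; ring
    · simp [h2, k2, Step.rise]
    · have h4 : StaysAbove 1 p := fun r hr => by have := h3 r hr; omega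
      simp [staysAbove_cons, staysAbove_append, Step.rise, h2, h4, k3]

theorem Decomposed.totalWidth_eq {n : ℕ} {p : Path} (h : Decomposed n p) :
    totalWidth p = 2 * n := (isSchroderPath_iff.1 h.isSchroderPath).1

theorem Decomposed.totalRise_eq {n : ℕ} {p : Path} (h : Decomposed n p) :
    totalRise p = 0 := (isSchroderPath_iff.1 h.isSchroderPath).2.1

theorem Decomposed.staysAbove {n : ℕ} {p : Path} (h : Decomposed n p) :
    StaysAbove 0 p := (isSchroderPath_iff.1 h.isSchroderPath).2.2

/-- A path that ends below the axis has a first step that goes below the axis. -/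
theorem exists_first_passage (p : Path) : ∀ h : ℤ, 0 ≤ h → h + totalRise p < 0 →
    ∃ p₁ p₂, p = p₁ ++ Step.d :: p₂ ∧ h + totalRise p₁ = 0 ∧ StaysAbove h p₁ := by
  induction p with
  | nil => intro h h0 h1; simp at h1; omega
  | cons s p ih =>
    intro h h0 h1
    by_cases hs : 0 ≤ h + s.rise
    · obtain ⟨p₁, p₂, rfl, h2, h3⟩ := ih (h + s.rise) hs (by simpa [add_assoc] using h1)
      exact ⟨s :: p₁, p₂, rfl, by simpa [add_assoc] using h2, staysAbove_cons.2 ⟨h0, h3⟩⟩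
    · cases s <;> simp only [Step.rise] at hs
      · omega
      · exact ⟨[], p, rfl, by simp; omega, staysAbove_nil.2 h0⟩
      · omega

theorem even_totalWidth_add_totalRise (p : Path) : Even ((totalWidth p : ℤ) + totalRise p) := by
  induction p with
  | nil => simp
  | cons s p ih =>
    have : Even ((s.width : ℤ) + s.rise) := by cases s <;> simp [Step.width, Step.rise]
    rw [totalWidth_cons, totalRise_cons, Nat.cast_add, add_add_add_comm]
    exact this.add ih

/-- The induction is on a bound for the length, because the parts of an arch are not tails of the
path. -/
theorem decomposed_of_staysAbove (N : ℕ) : ∀ (p : Path), p.length ≤ N → ∀ n : ℕ,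
    totalWidth p = 2 * n → totalRise p = 0 → StaysAbove 0 p → Decomposed n p := by
  induction N with
  | zero =>
    intro p hp n h1 _ _
    obtain rfl : p = [] := List.length_eq_zero_iff.1 (by omega)
    obtain rfl : n = 0 := by simp at h1; omega
    exact .nil
  | succ N ih =>
    intro p hp n h1 h2 h3
    match p, hp, h1, h2, h3 with
    | [], _, h1, _, _ =>
      obtain rfl : n = 0 := by simp at h1; omega
      exact .nil
    | .e :: p, hp, h1, h2, h3 =>
      simp [Step.width] at h1
      simp [Step.rise] at h2
      obtain ⟨k, rfl⟩ : ∃ k, n = k + 1 := ⟨n - 1, by omega⟩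
      exact .level (ih p (by simp at hp; omega) k (by omega) h2
        (by simpa [Step.rise] using (staysAbove_cons.1 h3).2))
    | .d :: p, hp, h1, h2, h3 =>
      have := (staysAbove_cons.1 h3).2.nonneg
      simp [Step.rise] at this
    | .u :: p, hp, h1, h2, h3 =>
      simp [Step.rise] at h2
      -- After the `u` the total rise is `-1`; the first passage below the new level is the step of
      -- first return.
      obtain ⟨p₁, p₂, rfl, h4, h5⟩ := exists_first_passage p 0 le_rfl (by omega)
      rw [zero_add] at h4
      simp [Step.width] at h1
      simp [Step.rise, h4] at h2
      simp [staysAbove_cons, staysAbove_append, Step.rise, h4] at h3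
      -- Parity turns rise `0` into even width, so the inner part has a semilength.
      obtain ⟨a, ha⟩ := even_totalWidth_add_totalRise p₁
      rw [h4] at ha
      simp at hp
      obtain ⟨i, hi⟩ : ∃ i : ℕ, totalWidth p₁ = 2 * i := ⟨a.toNat, by omega⟩
      obtain ⟨m, rfl⟩ : ∃ m, n = i + m + 1 := ⟨n - i - 1, by omega⟩
      exact .arch (ih p₁ (by omega) i hi h4 h5) (ih p₂ (by omega) m (by omega) h2 h3.2)

theorem isSchroderPath_iff_decomposed {n : ℕ} {p : Path} :
    IsSchroderPath n p ↔ Decomposed n p :=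
  ⟨fun h => by
    obtain ⟨h1, h2, h3⟩ := isSchroderPath_iff.1 h
    exact decomposed_of_staysAbove _ p le_rfl n h1 h2 h3, fun h => h.isSchroderPath⟩

/-- Since `p` ends on the axis, a `d` right after it would go below. -/
theorem Decomposed.append_down_not_prefix {i i' : ℕ} {p p' : Path} (hp : Decomposed i p)
    (hp' : Decomposed i' p') (r : Path) : p' ≠ p ++ Step.d :: r := by
  rintro rfl
  have := hp'.staysAbove
  rw [staysAbove_append, staysAbove_cons] at this
  have := this.2.2.nonneg
  simp [hp.totalRise_eq, Step.rise] at this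

/-- The first-return decomposition is unique. -/
theorem Decomposed.arch_inj {i i' : ℕ} {p p' q q' : Path} (hp : Decomposed i p)
    (hp' : Decomposed i' p') (h : p ++ Step.d :: q = p' ++ Step.d :: q') : p = p' ∧ q = q' := by
  rcases List.append_eq_append_iff.1 h with ⟨a, h1, h2⟩ | ⟨a, h1, h2⟩
  · cases a with
    | nil => simp at h1 h2; exact ⟨h1.symm, h2⟩
    | cons s a =>
      simp only [List.cons_append, List.cons.injEq] at h2
      obtain ⟨rfl, -⟩ := h2
      exact absurd h1 (hp.append_down_not_prefix hp' a)
  · cases a with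
    | nil => simp at h1 h2; exact ⟨h1, h2.symm⟩
    | cons s a =>
      simp only [List.cons_append, List.cons.injEq] at h2
      obtain ⟨rfl, -⟩ := h2
      exact absurd h1 (hp'.append_down_not_prefix hp a)

theorem Decomposed.unique {n m : ℕ} {p : Path} (h : Decomposed n p) (h' : Decomposed m p) :
    n = m := by
  have := h.totalWidth_eq
  have := h'.totalWidth_eq
  omega

/-! ### Heights and dots of decomposed paths. -/

theorem Step.width_pos (s : Step) : 0 < s.width := by cases s <;> simp [Step.width]

theorem height_zero (p : Path) : height p 0 = 0 := by
  cases p <;> simp [height]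

theorem height_cons_of_le {s : Step} {p : Path} {x : ℝ} (h : x ≤ s.width) :
    height (s :: p) x = (s.rise / s.width : ℝ) * x := by
  rw [height, if_pos h]

/-- Both branches of `height` agree at the junction, so later case splits may use weak inequalities.
-/
theorem height_cons_of_ge {s : Step} {p : Path} {x : ℝ} (h : (s.width : ℝ) ≤ x) :
    height (s :: p) x = s.rise + height p (x - s.width) := by
  rcases h.eq_or_lt with rfl | h
  · have : (s.width : ℝ) ≠ 0 := by exact_mod_cast s.width_pos.ne'
    rw [height_cons_of_le le_rfl, sub_self, height_zero, div_mul_cancel₀ _ this, add_zero]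
  · rw [height, if_neg (not_le.2 h)]

theorem height_append_of_le {p q : Path} : ∀ {x : ℝ}, 0 ≤ x → x ≤ totalWidth p →
    height (p ++ q) x = height p x := by
  induction p with
  | nil =>
    intro x h0 h1
    obtain rfl : x = 0 := le_antisymm (by simpa using h1) h0
    simp [height_zero]
  | cons s p ih =>
    intro x h0 h1
    rw [List.cons_append]
    rcases le_total x s.width with h | h
    · rw [height_cons_of_le h, height_cons_of_le h]
    · rw [height_cons_of_ge h, height_cons_of_ge h, ih (by linarith)]
      rw [totalWidth_cons] at h1
      push_cast at h1
      linarith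

theorem height_append_of_ge {p q : Path} : ∀ {x : ℝ}, (totalWidth p : ℝ) ≤ x →
    height (p ++ q) x = totalRise p + height q (x - totalWidth p) := by
  induction p with
  | nil => intro x _; simp
  | cons s p ih =>
    intro x h1
    rw [totalWidth_cons] at h1
    push_cast at h1
    have h2 : (0 : ℝ) ≤ totalWidth p := Nat.cast_nonneg _
    rw [List.cons_append, height_cons_of_ge (by linarith), ih (by linarith), totalWidth_cons,
      totalRise_cons]
    push_cast
    rw [sub_sub, add_assoc]

theorem height_level_of_le {p : Path} {x : ℝ} (h : x ≤ 2) : height (Step.e :: p) x = 0 := by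
  rw [height_cons_of_le (by simpa [Step.width] using h)]
  simp [Step.rise]

theorem height_level_of_ge {p : Path} {x : ℝ} (h : 2 ≤ x) :
    height (Step.e :: p) x = height p (x - 2) := by
  rw [height_cons_of_ge (by simpa [Step.width] using h)]
  simp [Step.rise, Step.width]

section arch

variable {i : ℕ} {p q : Path} {x : ℝ}

theorem height_arch_of_le_one (h : x ≤ 1) : height (Step.u :: (p ++ Step.d :: q)) x = x := by
  rw [height_cons_of_le (by simpa [Step.width] using h)]
  simp [Step.rise, Step.width]

theorem height_arch_of_ge_one (h : 1 ≤ x) :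
    height (Step.u :: (p ++ Step.d :: q)) x = 1 + height (p ++ Step.d :: q) (x - 1) := by
  rw [height_cons_of_ge (by simpa [Step.width] using h)]
  simp [Step.rise, Step.width]

theorem height_arch_inner (hp : Decomposed i p) (h : 1 ≤ x) (h' : x ≤ 2 * i + 1) :
    height (Step.u :: (p ++ Step.d :: q)) x = 1 + height p (x - 1) := by
  rw [height_arch_of_ge_one h, height_append_of_le (by linarith)]
  rw [hp.totalWidth_eq]
  push_cast
  linarith

theorem height_arch_down (hp : Decomposed i p) (h : 2 * i + 1 ≤ x) (h' : x ≤ 2 * i + 2) :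
    height (Step.u :: (p ++ Step.d :: q)) x = 2 * i + 2 - x := by
  have hi : (0 : ℝ) ≤ i := Nat.cast_nonneg _
  rw [height_arch_of_ge_one (by linarith), height_append_of_ge, hp.totalRise_eq,
    hp.totalWidth_eq, height_cons_of_le]
  · simp [Step.rise, Step.width]; ring
  · simp [Step.width]; linarith
  · rw [hp.totalWidth_eq]; push_cast; linarith

theorem height_arch_outer (hp : Decomposed i p) (h : 2 * i + 2 ≤ x) :
    height (Step.u :: (p ++ Step.d :: q)) x = height q (x - (2 * i + 2)) := by
  have hi : (0 : ℝ) ≤ i := Nat.cast_nonneg _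
  rw [height_arch_of_ge_one (by linarith), height_append_of_ge, hp.totalRise_eq,
    hp.totalWidth_eq, height_cons_of_ge]
  · simp only [Step.rise, Step.width]; push_cast
    rw [show x - 1 - 2 * (i : ℝ) - 1 = x - (2 * i + 2) by ring]; ring
  · simp [Step.width]; linarith
  · rw [hp.totalWidth_eq]; push_cast; linarith

end arch

theorem Decomposed.height_bounds {n : ℕ} {p : Path} (hp : Decomposed n p) : ∀ {x : ℝ},
    0 ≤ x → x ≤ 2 * n → 0 ≤ height p x ∧ height p x ≤ x := by
  induction hp with
  | nil => intro x h0 _; simpa [height] using h0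
  | @level n p hp ih =>
    intro x h0 h1
    push_cast at h1
    rcases le_total x 2 with h | h
    · rw [height_level_of_le h]; exact ⟨le_rfl, h0⟩
    · rw [height_level_of_ge h]
      have := @ih (x - 2) (by linarith) (by linarith)
      exact ⟨this.1, by linarith⟩
  | @arch i m p q hp hq ihp ihq =>
    intro x h0 h1
    push_cast at h1
    have hi : (0 : ℝ) ≤ i := Nat.cast_nonneg _
    rcases le_total x 1 with h | h
    · rw [height_arch_of_le_one h]; exact ⟨h0, le_rfl⟩
    rcases le_total x (2 * i + 1) with h' | h'
    · rw [height_arch_inner hp h h']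
      have := @ihp (x - 1) (by linarith) (by linarith)
      exact ⟨by linarith, by linarith⟩
    rcases le_total x (2 * i + 2) with h'' | h''
    · rw [height_arch_down hp h' h'']; exact ⟨by linarith, by linarith⟩
    · rw [height_arch_outer hp h'']
      have := @ihq (x - (2 * i + 2)) (by linarith) (by linarith)
      exact ⟨this.1, by linarith⟩

/-- Slopes are at most one, so a dot beneath the path satisfies `Y < X < 8 * n` and the bound on `a`
is automatic; the residues give `0 < Y`. -/
theorem Decomposed.mem_dots {n : ℕ} {p : Path} (hp : Decomposed n p) {P : Dot} :
    P ∈ dots n p ↔ ((P.1 % 8 = 1 ∧ P.2 % 8 = 5) ∨ (P.1 % 8 = 5 ∧ P.2 % 8 = 1)) ∧ P.1 < 8 * n ∧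
      (P.2 : ℝ) / 4 < height p ((P.1 : ℝ) / 4) := by
  obtain ⟨X, Y⟩ := P
  simp only [dots, Finset.mem_filter, Finset.mem_union, Finset.mem_image, Finset.mem_product,
    Finset.mem_range, Prod.exists, Prod.mk.injEq, Beneath]
  constructor
  · rintro ⟨⟨m, a, ⟨hm, ha⟩, rfl, rfl⟩ | ⟨m, a, ⟨hm, ha⟩, rfl, rfl⟩, -, h⟩
    · exact ⟨by omega, by omega, h⟩
    · exact ⟨by omega, by omega, h⟩
  · rintro ⟨h1, h2, h3⟩
    have hX : (X : ℝ) ≤ 8 * n := by exact_mod_cast h2.le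
    have h4 := (hp.height_bounds (x := (X : ℝ) / 4) (by positivity) (by linarith)).2
    have h5 : Y < X := by
      have : (Y : ℝ) < X := by linarith
      exact_mod_cast this
    have h6 : (0 : ℝ) < Y := by
      have : 0 < Y := by omega
      exact_mod_cast this
    refine ⟨?_, by linarith, h3⟩
    rcases h1 with h1 | h1
    · exact Or.inl ⟨X / 8, Y / 8, by omega, by omega, by omega⟩
    · exact Or.inr ⟨X / 8, Y / 8, by omega, by omega, by omega⟩

theorem Decomposed.snd_lt_fst {n : ℕ} {p : Path} (hp : Decomposed n p) {P : Dot}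
    (hP : P ∈ dots n p) : P.2 < P.1 := by
  obtain ⟨-, h2, h3⟩ := hp.mem_dots.1 hP
  have hX : (P.1 : ℝ) ≤ 8 * n := by exact_mod_cast h2.le
  have h4 := (hp.height_bounds (x := (P.1 : ℝ) / 4) (by positivity) (by linarith)).2
  have : (P.2 : ℝ) < P.1 := by linarith
  exact_mod_cast this

/-! ### Lines and translations -/

theorem rightmost_eq {D : Finset Dot} {P : Dot} (hP : P ∈ D)
    (h : ∀ Q ∈ D, Q.1 ≤ P.1 ∧ (Q.1 = P.1 → Q.2 ≤ P.2)) : rightmost D = P := by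
  have h1 : D.sup Prod.fst = P.1 :=
    le_antisymm (Finset.sup_le fun Q hQ => (h Q hQ).1) (Finset.le_sup (f := Prod.fst) hP)
  refine Prod.ext h1 ?_
  simp only [rightmost, h1]
  refine le_antisymm (Finset.sup_le fun Q hQ => ?_)
    (Finset.le_sup (f := Prod.snd) (Finset.mem_filter.2 ⟨hP, rfl⟩))
  rw [Finset.mem_filter] at hQ
  exact (h Q hQ.1).2 hQ.2

theorem le_rightmost {D : Finset Dot} {Q : Dot} (hQ : Q ∈ D) :
    Q.1 ≤ (rightmost D).1 ∧ (Q.1 = (rightmost D).1 → Q.2 ≤ (rightmost D).2) :=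
  ⟨Finset.le_sup (f := Prod.fst) hQ, fun h =>
    Finset.le_sup (f := Prod.snd) (Finset.mem_filter.2 ⟨hQ, h⟩)⟩

theorem mem_lineDots {n : ℕ} {p : Path} {P Q : Dot} :
    Q ∈ lineDots n p P ↔ Q = P ∨ Q ∈ dots n p ∧ Reaches p P Q := by
  classical
  simp [lineDots]

theorem lineDots_subset {n : ℕ} {p : Path} {P : Dot} (hP : P ∈ dots n p) :
    lineDots n p P ⊆ dots n p := by
  intro Q hQ
  rw [mem_lineDots] at hQ
  rcases hQ with rfl | hQ
  · exact hP
  · exact hQ.1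

theorem leftEnd_mem_lineDots (n : ℕ) (p : Path) (P : Dot) : leftEnd n p P ∈ lineDots n p P := by
  obtain ⟨Q, hQ, h⟩ := Finset.exists_mem_eq_inf' (s := lineDots n p P)
    ⟨P, Finset.mem_insert_self _ _⟩ Prod.fst
  have hQ2 : Q.2 = P.2 := by
    rw [mem_lineDots] at hQ
    rcases hQ with rfl | hQ
    · rfl
    · exact hQ.2.1
  have : leftEnd n p P = Q := Prod.ext h hQ2.symm
  rw [this]
  exact hQ

theorem leftEnd_eq {n : ℕ} {p : Path} {P Q : Dot} (hQ : Q ∈ lineDots n p P)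
    (h : ∀ R ∈ lineDots n p P, Q.1 ≤ R.1) (h2 : Q.2 = P.2) : leftEnd n p P = Q :=
  Prod.ext (le_antisymm (Finset.inf'_le Prod.fst hQ)
    (Finset.le_inf' ⟨P, Finset.mem_insert_self _ _⟩ Prod.fst h)) h2.symm

theorem lineWords_empty (n : ℕ) (p : Path) : lineWords n p ∅ = [] := by
  rw [lineWords]; simp

theorem lineWords_of_nonempty {n : ℕ} {p : Path} {D : Finset Dot} (h : D.Nonempty) :
    lineWords n p D = (List.range' (label (leftEnd n p (rightmost D)))
      (label (rightmost D) + 1 - label (leftEnd n p (rightmost D)))).reverse ::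
        lineWords n p (D \ lineDots n p (rightmost D)) := by
  rw [lineWords, dif_pos h]

/-- A part of the path `p` is the path `q`, translated by `(b/4 + 2c, b/4)`. -/
structure IsTranslate (m : ℕ) (q : Path) (n : ℕ) (p : Path) (b c : ℕ) : Prop where
  inner : Decomposed m q
  outer : Decomposed n p
  four_dvd : 4 ∣ b
  width_le : 8 * m + (b + 8 * c) ≤ 8 * n
  height_eq : ∀ z : ℝ, 0 ≤ z → z ≤ 2 * m → height p (z + (b + 8 * c : ℕ) / 4) = height q z + b / 4

/-- Translation of dots. -/
def translate (b c : ℕ) (P : Dot) : Dot := (P.1 + (b + 8 * c), P.2 + b)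

theorem translate_injective (b c : ℕ) : Function.Injective (translate b c) := by
  intro P Q h
  simp only [translate, Prod.mk.injEq, Nat.add_right_cancel_iff] at h
  exact Prod.ext h.1 h.2

/-- Diagonal moves keep the label, and `8 * c` quarter units to the right add `c`. The hypothesis
excludes truncated subtraction. -/
theorem label_translate {b c : ℕ} {P : Dot} (h : P.2 < P.1) :
    label (translate b c P) = label P + c := by
  simp only [label, translate]
  omega

namespace IsTranslate

variable {m n b c : ℕ} {p q : Path}

theorem translate_mem_dots_iff (T : IsTranslate m q n p b c) {P : Dot} (hP : P.1 < 8 * m) :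
    translate b c P ∈ dots n p ↔ P ∈ dots m q := by
  rw [T.outer.mem_dots, T.inner.mem_dots]
  have h1 := T.four_dvd
  have h2 := T.width_le
  have hX : (P.1 : ℝ) ≤ 8 * m := by exact_mod_cast hP.le
  have h3 := T.height_eq (P.1 / 4) (by positivity) (by linarith)
  simp only [translate]
  push_cast at h3 ⊢
  rw [add_div (P.1 : ℝ), h3, add_div (P.2 : ℝ), add_lt_add_iff_right]
  -- Since `4 ∣ b`, translation preserves or interchanges the two residue classes of dots.
  refine and_congr (by omega) (and_congr (by omega) Iff.rfl)

theorem fst_lt (T : IsTranslate m q n p b c) {P : Dot} (hP : P ∈ dots m q) : P.1 < 8 * m :=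
  (T.inner.mem_dots.1 hP).2.1

theorem translate_mem_dots (T : IsTranslate m q n p b c) {P : Dot} (hP : P ∈ dots m q) :
    translate b c P ∈ dots n p := (T.translate_mem_dots_iff (T.fst_lt hP)).2 hP

theorem reaches_iff (T : IsTranslate m q n p b c) {P Q : Dot} (hP : P ∈ dots m q) :
    Reaches p (translate b c P) (translate b c Q) ↔ Reaches q P Q := by
  have hX : (P.1 : ℝ) ≤ 8 * m := by exact_mod_cast (T.fst_lt hP).le
  have hQ0 : (0 : ℝ) ≤ Q.1 := Nat.cast_nonneg _
  simp only [Reaches, translate, Nat.add_right_cancel_iff, Nat.add_le_add_iff_right]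
  refine and_congr Iff.rfl (and_congr Iff.rfl ⟨fun H z h1 h2 => ?_, fun H z h1 h2 => ?_⟩)
  · have := H (z + (b + 8 * c : ℕ) / 4) (by push_cast; linarith) (by push_cast; linarith)
    rw [T.height_eq z (by linarith) (by linarith)] at this
    push_cast at this
    linarith
  · push_cast at h1 h2
    have h3 := H (z - (b + 8 * c : ℕ) / 4) (by push_cast; linarith) (by push_cast; linarith)
    have h4 := T.height_eq (z - (b + 8 * c : ℕ) / 4) (by push_cast; linarith)
      (by push_cast; linarith)
    rw [sub_add_cancel] at h4
    rw [h4]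
    push_cast at h3 ⊢
    linarith

theorem lineDots_translate (T : IsTranslate m q n p b c) {P : Dot} (hP : P ∈ dots m q) :
    lineDots n p (translate b c P) = (lineDots m q P).image (translate b c) := by
  ext Q
  simp only [mem_lineDots, Finset.mem_image]
  constructor
  · rintro (rfl | ⟨hQ, hr⟩)
    · exact ⟨P, Or.inl rfl, rfl⟩
    · have hP0 : (0 : ℝ) ≤ P.1 := Nat.cast_nonneg _
      have hP2 : (0 : ℝ) < P.2 := by
        have := (T.inner.mem_dots.1 hP).1
        have : 0 < P.2 := by omega
        exact_mod_cast this
      -- At its left end the translated part has height `b / 4`, below the line, so the line cannot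
      -- leave the part.
      have hle : b + 8 * c ≤ Q.1 := by
        by_contra! hlt
        have hlt' : (Q.1 : ℝ) ≤ (b + 8 * c : ℕ) := by exact_mod_cast hlt.le
        have h1 := hr.2.2 ((b + 8 * c : ℕ) / 4) (by linarith)
          (by simp only [translate]; push_cast; linarith)
        have h2 := T.height_eq 0 le_rfl (by positivity)
        rw [zero_add, height_zero] at h2
        rw [h2] at h1
        simp only [translate] at h1
        push_cast at h1
        linarith
      have h1 := hr.1
      have h2 := hr.2.1
      simp only [translate] at h1 h2
      obtain ⟨Q', rfl⟩ : ∃ Q', Q = translate b c Q' :=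
        ⟨(Q.1 - (b + 8 * c), Q.2 - b), by simp only [translate]; ext <;> dsimp only <;> omega⟩
      have h3 := T.fst_lt hP
      simp only [translate] at h2
      exact ⟨Q', Or.inr ⟨(T.translate_mem_dots_iff (by omega)).1 hQ, (T.reaches_iff hP).1 hr⟩, rfl⟩
  · rintro ⟨Q', rfl | ⟨hQ, hr⟩, rfl⟩
    · exact Or.inl rfl
    · exact Or.inr ⟨T.translate_mem_dots hQ, (T.reaches_iff hP).2 hr⟩

theorem leftEnd_translate (T : IsTranslate m q n p b c) {P : Dot} (hP : P ∈ dots m q) :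
    leftEnd n p (translate b c P) = translate b c (leftEnd m q P) := by
  refine leftEnd_eq ?_ ?_ rfl
  · rw [T.lineDots_translate hP]
    exact Finset.mem_image_of_mem _ (leftEnd_mem_lineDots _ _ _)
  · rw [T.lineDots_translate hP]
    intro R hR
    obtain ⟨R, hRD, rfl⟩ := Finset.mem_image.1 hR
    exact Nat.add_le_add_right (Finset.inf'_le (f := Prod.fst) hRD) _

/-- The lines of a translated part of a path are drawn independently of the dots further to
the left. -/
theorem lineWords_translate (T : IsTranslate m q n p b c) {R : Finset Dot}
    (hR : ∀ P ∈ R, P.1 < b + 8 * c) : ∀ {D : Finset Dot}, D ⊆ dots m q →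
    lineWords n p (D.image (translate b c) ∪ R) =
      (lineWords m q D).map (List.map (· + c)) ++ lineWords n p R := by
  intro D
  induction D using Finset.strongInduction with
  | H D ih =>
    intro hD
    rcases D.eq_empty_or_nonempty with rfl | hne
    · simp [lineWords_empty]
    · have hmem := hD (rightmost_mem hne)
      -- All of `R` lies to the left of the translated dots, so it does not affect which line comes
      -- next.
      have h1 : rightmost (D.image (translate b c) ∪ R) = translate b c (rightmost D) := by
        refine rightmost_eq (Finset.mem_union_left _
          (Finset.mem_image_of_mem _ (rightmost_mem hne))) fun Q hQ => ?_
        rcases Finset.mem_union.1 hQ with hQ | hQ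
        · obtain ⟨Q, hQD, rfl⟩ := Finset.mem_image.1 hQ
          have := le_rightmost hQD
          simp only [translate]
          exact ⟨by omega, fun h => by have := this.2 (by omega); omega⟩
        · have := hR Q hQ
          simp only [translate]
          exact ⟨by omega, fun h => by omega⟩
      have h2 : (D.image (translate b c) ∪ R) \ lineDots n p (translate b c (rightmost D)) =
          (D \ lineDots m q (rightmost D)).image (translate b c) ∪ R := by
        rw [T.lineDots_translate hmem, Finset.union_sdiff_distrib,
          Finset.image_sdiff _ _ (translate_injective b c)]
        congr 1
        refine Finset.sdiff_eq_self_of_disjoint (Finset.disjoint_left.2 fun Q hQ hQ' => ?_)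
        obtain ⟨Q, -, rfl⟩ := Finset.mem_image.1 hQ'
        have := hR _ hQ
        simp only [translate] at this
        omega
      have hss : D \ lineDots m q (rightmost D) ⊂ D :=
        Finset.ssubset_iff_subset_ne.2 ⟨Finset.sdiff_subset, fun he =>
          (Finset.mem_sdiff.1 (he.ge (rightmost_mem hne))).2 (mem_lineDots.2 (Or.inl rfl))⟩
      rw [lineWords_of_nonempty ((hne.image _).mono Finset.subset_union_left), h1, h2,
        ih _ hss (Finset.sdiff_subset.trans hD), lineWords_of_nonempty hne,
        T.leftEnd_translate hmem, label_translate (T.inner.snd_lt_fst hmem),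
        label_translate (T.inner.snd_lt_fst (lineDots_subset hmem (leftEnd_mem_lineDots _ _ _))),
        List.map_cons, List.cons_append, List.map_reverse]
      congr 2
      simp only [Nat.add_comm _ c]
      rw [List.map_add_range', show c + label (rightmost D) + 1 - (c + label (leftEnd m q
        (rightmost D))) = label (rightmost D) + 1 - label (leftEnd m q (rightmost D)) by omega]

end IsTranslate

/-! ### Words of the lines along the decomposition. -/

/-- The words of all lines drawn beneath a path. -/
noncomputable def pathWords (n : ℕ) (p : Path) : List (List ℕ) := lineWords n p (dots n p)

theorem pathWords_nil : pathWords 0 [] = [] := by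
  have : dots 0 [] = ∅ := by simp [dots]
  rw [pathWords, this, lineWords_empty]

theorem Decomposed.isTranslate_level {n : ℕ} {p : Path} (hp : Decomposed n p) :
    IsTranslate n p (n + 1) (Step.e :: p) 0 1 where
  inner := hp
  outer := hp.level
  four_dvd := by norm_num
  width_le := by omega
  height_eq z h0 _ := by
    rw [height_level_of_ge (by norm_num; linarith)]
    norm_num

/-- No dot lies beneath the initial `e`, and everything else moves two units to the right, which is
one label. -/
theorem pathWords_level {n : ℕ} {p : Path} (hp : Decomposed n p) :
    pathWords (n + 1) (Step.e :: p) = (pathWords n p).map (List.map (· + 1)) := by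
  have T := hp.isTranslate_level
  have h : dots (n + 1) (Step.e :: p) = (dots n p).image (translate 0 1) ∪ ∅ := by
    ext Q
    rw [Finset.union_empty, Finset.mem_image]
    constructor
    · intro hQ
      have h1 := T.outer.mem_dots.1 hQ
      have h8 : 8 ≤ Q.1 := by
        by_contra! hlt
        have : (Q.1 : ℝ) ≤ 8 := by exact_mod_cast hlt.le
        rw [height_level_of_le (by linarith)] at h1
        have : (0 : ℝ) ≤ Q.2 := Nat.cast_nonneg _
        linarith [h1.2.2]
      obtain ⟨Q, rfl⟩ : ∃ Q', Q = translate 0 1 Q' :=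
        ⟨(Q.1 - 8, Q.2), by simp only [translate]; ext <;> dsimp only <;> omega⟩
      have h2 := h1.2.1
      simp only [translate] at h2
      exact ⟨Q, (T.translate_mem_dots_iff (by omega)).1 hQ, rfl⟩
    · rintro ⟨Q, hQ, rfl⟩
      exact T.translate_mem_dots hQ
  rw [pathWords, h, T.lineWords_translate (by simp) subset_rfl, lineWords_empty, List.append_nil,
    pathWords]

section arch

variable {i m : ℕ} {p q : Path}

theorem Decomposed.isTranslate_arch_outer (hp : Decomposed i p) (hq : Decomposed m q) :
    IsTranslate m q (i + m + 1) (Step.u :: (p ++ Step.d :: q)) 0 (i + 1) where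
  inner := hq
  outer := hp.arch hq
  four_dvd := by norm_num
  width_le := by omega
  height_eq z h0 _ := by
    rw [height_arch_outer hp (by push_cast; linarith)]
    push_cast
    rw [show z + (0 + 8 * ((i : ℝ) + 1)) / 4 - (2 * i + 2) = z by ring]
    ring

theorem Decomposed.isTranslate_arch_inner (hp : Decomposed i p) (hq : Decomposed m q) :
    IsTranslate i p (i + m + 1) (Step.u :: (p ++ Step.d :: q)) 4 0 where
  inner := hp
  outer := hp.arch hq
  four_dvd := by norm_num
  width_le := by omega
  height_eq z h0 h1 := by
    rw [height_arch_inner hp (by norm_num; linarith) (by norm_num; linarith)]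
    norm_num
    ring

/-- The dots of the lowest row beneath the first arch. -/
def bottomRow (i : ℕ) : Finset Dot := (Finset.range (i + 1)).image fun k => (8 * k + 5, 1)

theorem mem_bottomRow {Q : Dot} :
    Q ∈ bottomRow i ↔ Q.1 % 8 = 5 ∧ Q.1 < 8 * (i + 1) ∧ Q.2 = 1 := by
  obtain ⟨X, Y⟩ := Q
  simp only [bottomRow, Finset.mem_image, Finset.mem_range, Prod.mk.injEq]
  constructor
  · rintro ⟨k, hk, rfl, rfl⟩
    omega
  · rintro ⟨h1, h2, h3⟩
    exact ⟨X / 8, by omega, by omega, by omega⟩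

/-- The bottom row has height `1/4` and abscissas from `5/4` to `2 * i + 5/4`, so one line passes
through all of it. The value `3/4` is attained beneath the closing down step. -/
theorem height_arch_ge (hp : Decomposed i p) {x : ℝ} (h : 1 ≤ x) (h' : x ≤ 2 * i + 5 / 4) :
    3 / 4 ≤ height (Step.u :: (p ++ Step.d :: q)) x := by
  rcases le_total x (2 * i + 1) with h1 | h1
  · rw [height_arch_inner hp h h1]
    have := (hp.height_bounds (x := x - 1) (by linarith) (by linarith)).1
    linarith
  · rw [height_arch_down hp h1 (by linarith)]
    linarith

theorem dots_arch (hp : Decomposed i p) (hq : Decomposed m q) :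
    dots (i + m + 1) (Step.u :: (p ++ Step.d :: q)) =
      (dots m q).image (translate 0 (i + 1)) ∪
        (bottomRow i ∪ (dots i p).image (translate 4 0)) := by
  have T := hp.isTranslate_arch_outer hq
  have T' := hp.isTranslate_arch_inner hq
  ext Q
  simp only [Finset.mem_union, Finset.mem_image]
  constructor
  · intro hQ
    have h1 := T.outer.mem_dots.1 hQ
    by_cases h8 : 8 * (i + 1) ≤ Q.1
    · obtain ⟨Q, rfl⟩ : ∃ Q', Q = translate 0 (i + 1) Q' :=
        ⟨(Q.1 - 8 * (i + 1), Q.2), by simp only [translate]; ext <;> dsimp only <;> omega⟩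
      have h2 := h1.2.1
      simp only [translate] at h2
      exact Or.inl ⟨Q, (T.translate_mem_dots_iff (by omega)).1 hQ, rfl⟩
    · right
      by_cases hrow : Q.2 = 1
      · exact Or.inl (mem_bottomRow.2 ⟨by omega, by omega, hrow⟩)
      · right
        have h5 : 5 ≤ Q.2 := by omega
        have h5' : (5 : ℝ) ≤ Q.2 := by exact_mod_cast h5
        have hlt := T.outer.snd_lt_fst hQ
        -- Here the closing down step has height `3/4`, so only the bottom row meets this column.
        have hX : Q.1 ≠ 8 * i + 5 := by
          intro hX
          have h2 := h1.2.2
          rw [hX] at h2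
          push_cast at h2
          rw [height_arch_down hp (by linarith) (by linarith)] at h2
          linarith
        obtain ⟨Q, rfl⟩ : ∃ Q', Q = translate 4 0 Q' :=
          ⟨(Q.1 - 4, Q.2 - 4), by simp only [translate]; ext <;> dsimp only <;> omega⟩
        simp only [translate] at h1 h8 hX
        exact ⟨Q, (T'.translate_mem_dots_iff (by omega)).1 hQ, rfl⟩
  · rintro (⟨Q, hQ, rfl⟩ | hQ | ⟨Q, hQ, rfl⟩)
    · exact T.translate_mem_dots hQ
    · rw [mem_bottomRow] at hQ
      rw [T.outer.mem_dots]
      refine ⟨by omega, by omega, ?_⟩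
      have h1 : (5 : ℝ) ≤ Q.1 := by
        have : 5 ≤ Q.1 := by omega
        exact_mod_cast this
      have h2 : (Q.1 : ℝ) ≤ 8 * i + 5 := by
        have : Q.1 ≤ 8 * i + 5 := by omega
        exact_mod_cast this
      have := height_arch_ge (q := q) hp (x := (Q.1 : ℝ) / 4) (by linarith) (by linarith)
      rw [hQ.2.2]
      push_cast
      linarith
    · exact T'.translate_mem_dots hQ

theorem lineDots_bottomRow (hp : Decomposed i p) (hq : Decomposed m q) :
    lineDots (i + m + 1) (Step.u :: (p ++ Step.d :: q)) (8 * i + 5, 1) = bottomRow i := by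
  have T := hp.isTranslate_arch_outer hq
  ext Q
  rw [mem_lineDots]
  constructor
  · rintro (rfl | ⟨hQ, h1, h2, -⟩)
    · rw [mem_bottomRow]; dsimp only; omega
    · have := (T.outer.mem_dots.1 hQ).1
      rw [mem_bottomRow]
      dsimp only at h1 h2
      omega
  · intro hQ
    right
    refine ⟨by rw [dots_arch hp hq]; simp [hQ], ?_⟩
    rw [mem_bottomRow] at hQ
    refine ⟨hQ.2.2, by dsimp only; omega, fun z h1 h2 => ?_⟩
    have h3 : (5 : ℝ) ≤ Q.1 := by
      have : 5 ≤ Q.1 := by omega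
      exact_mod_cast this
    push_cast at h2
    have := height_arch_ge (q := q) hp (x := z) (by linarith) (by linarith)
    push_cast
    linarith

/-- The dots of `q` lie beyond abscissa `2 * (i + 1)`, and the last dot of the bottom row lies to
the right of all dots of `p`; this fixes the order of the lines. -/
theorem pathWords_arch (hp : Decomposed i p) (hq : Decomposed m q) :
    pathWords (i + m + 1) (Step.u :: (p ++ Step.d :: q)) =
      (pathWords m q).map (List.map (· + (i + 1))) ++
        (List.range' 1 (i + 1)).reverse :: pathWords i p := by
  have T := hp.isTranslate_arch_outer hq
  have T' := hp.isTranslate_arch_inner hq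
  have hmem : (8 * i + 5, 1) ∈ bottomRow i := by rw [mem_bottomRow]; dsimp only; omega
  have hright : rightmost (bottomRow i ∪ (dots i p).image (translate 4 0)) = (8 * i + 5, 1) := by
    refine rightmost_eq (Finset.mem_union_left _ hmem) fun Q hQ => ?_
    rcases Finset.mem_union.1 hQ with hQ | hQ
    · rw [mem_bottomRow] at hQ
      dsimp only
      omega
    · obtain ⟨Q, hQD, rfl⟩ := Finset.mem_image.1 hQ
      have h1 := T'.fst_lt hQD
      have h2 := (T'.inner.mem_dots.1 hQD).1
      simp only [translate]
      omega
  have hleft : leftEnd (i + m + 1) (Step.u :: (p ++ Step.d :: q)) (8 * i + 5, 1) = (5, 1) := by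
    refine leftEnd_eq ?_ ?_ rfl
    · rw [lineDots_bottomRow hp hq, mem_bottomRow]; dsimp only; omega
    · intro R hR
      rw [lineDots_bottomRow hp hq, mem_bottomRow] at hR
      dsimp only
      omega
  have hdiff : (bottomRow i ∪ (dots i p).image (translate 4 0)) \ bottomRow i =
      (dots i p).image (translate 4 0) ∪ ∅ := by
    rw [Finset.union_sdiff_left, Finset.union_empty]
    refine Finset.sdiff_eq_self_of_disjoint (Finset.disjoint_left.2 fun Q hQ hQ' => ?_)
    obtain ⟨Q, -, rfl⟩ := Finset.mem_image.1 hQ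
    rw [mem_bottomRow] at hQ'
    simp only [translate] at hQ'
    omega
  rw [pathWords, dots_arch hp hq, T.lineWords_translate ?_ subset_rfl,
    lineWords_of_nonempty ⟨_, Finset.mem_union_left _ hmem⟩, hright, hleft,
    lineDots_bottomRow hp hq, hdiff, T'.lineWords_translate (by simp) subset_rfl]
  · have h1 : label (8 * i + 5, 1) = i + 1 := by simp only [label]; omega
    have h2 : label (5, 1) = 1 := rfl
    rw [h1, h2, lineWords_empty]
    simp [pathWords]
  · intro Q hQ
    rcases Finset.mem_union.1 hQ with hQ | hQ
    · rw [mem_bottomRow] at hQ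
      omega
    · obtain ⟨Q, hQD, rfl⟩ := Finset.mem_image.1 hQ
      have h1 := T'.fst_lt hQD
      simp only [translate]
      omega

end arch

/-! ### Permutations of the natural numbers -/

/-- The product of the adjacent transpositions with the given indices. -/
def genPerm (L : List ℕ) : Equiv.Perm ℕ := (L.map fun i => Equiv.swap (i - 1) i).prod

@[simp] theorem genPerm_nil : genPerm [] = 1 := rfl

@[simp] theorem genPerm_cons (i : ℕ) (L : List ℕ) :
    genPerm (i :: L) = Equiv.swap (i - 1) i * genPerm L := by simp [genPerm]

@[simp] theorem genPerm_append (L M : List ℕ) : genPerm (L ++ M) = genPerm L * genPerm M := by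
  simp [genPerm]

/-- The permutation `g` acting on `k, k + 1, …`. -/
def shiftPerm (k : ℕ) (g : Equiv.Perm ℕ) : Equiv.Perm ℕ where
  toFun x := if x < k then x else k + g (x - k)
  invFun x := if x < k then x else k + g.symm (x - k)
  left_inv x := by
    by_cases h : x < k
    · simp [h]
    · simp [h]; omega
  right_inv x := by
    by_cases h : x < k
    · simp [h]
    · simp [h]; omega

theorem shiftPerm_apply (k : ℕ) (g : Equiv.Perm ℕ) (x : ℕ) :
    shiftPerm k g x = if x < k then x else k + g (x - k) := rfl

theorem shiftPerm_apply_add (k : ℕ) (g : Equiv.Perm ℕ) (x : ℕ) :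
    shiftPerm k g (x + k) = k + g x := by simp [shiftPerm_apply]

theorem shiftPerm_one (k : ℕ) : shiftPerm k 1 = 1 := by
  ext x
  simp only [shiftPerm_apply, Equiv.Perm.one_apply]
  split_ifs <;> omega

theorem shiftPerm_mul (k : ℕ) (g h : Equiv.Perm ℕ) :
    shiftPerm k (g * h) = shiftPerm k g * shiftPerm k h := by
  ext x
  by_cases hx : x < k <;> simp [shiftPerm_apply, hx]

theorem shiftPerm_swap (k a b : ℕ) :
    shiftPerm k (Equiv.swap a b) = Equiv.swap (a + k) (b + k) := by
  ext x
  simp only [shiftPerm_apply, Equiv.swap_apply_def]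
  split_ifs <;> omega

theorem shiftPerm_injective (k : ℕ) : Function.Injective (shiftPerm k) := by
  intro g h H
  ext x
  have := congrArg (fun f : Equiv.Perm ℕ => f (x + k)) H
  simpa [shiftPerm_apply_add] using this

theorem exists_eq_shiftPerm {k : ℕ} {h : Equiv.Perm ℕ} (hk : ∀ x < k, h x = x) :
    ∃ g, h = shiftPerm k g := by
  have h1 : ∀ x, k ≤ x → k ≤ h x := by
    intro x hx
    by_contra! hlt
    have := h.injective (hk _ hlt)
    omega
  have h2 : ∀ x, k ≤ x → k ≤ h.symm x := by
    intro x hx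
    by_contra! hlt
    have := hk _ hlt
    rw [Equiv.apply_symm_apply] at this
    omega
  refine ⟨⟨fun x => h (x + k) - k, fun x => h.symm (x + k) - k, fun x => ?_, fun x => ?_⟩, ?_⟩
  · have := h1 (x + k) (by omega)
    dsimp only
    rw [Nat.sub_add_cancel this]
    simp
  · have := h2 (x + k) (by omega)
    dsimp only
    rw [Nat.sub_add_cancel this]
    simp
  · ext x
    rw [shiftPerm_apply]
    split_ifs with hx
    · exact hk x hx
    · have := h1 x (by omega)
      simp only [Equiv.coe_fn_mk]
      rw [Nat.sub_add_cancel (by omega)]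
      omega

theorem genPerm_map_add {k : ℕ} {L : List ℕ} (hL : ∀ i ∈ L, 1 ≤ i) :
    genPerm (L.map (· + k)) = shiftPerm k (genPerm L) := by
  induction L with
  | nil => simp [shiftPerm_one]
  | cons i L ih =>
    have hi := hL i (by simp)
    rw [List.map_cons, genPerm_cons, genPerm_cons, shiftPerm_mul, shiftPerm_swap,
      ih fun j hj => hL j (by simp [hj]), show i + k - 1 = i - 1 + k by omega]

/-- A letter `i` acts on the 0-based positions `i - 1` and `i`; the cycle obtained is the
contribution of a bottom row. -/
theorem genPerm_range'_apply (k x : ℕ) :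
    genPerm (List.range' 1 k) x = if x < k then x + 1 else if x = k then 0 else x := by
  induction k generalizing x with
  | zero => simp
  | succ k ih =>
    rw [List.range'_1_concat, genPerm_append, Equiv.Perm.mul_apply, genPerm_cons, genPerm_nil,
      mul_one, ih, Equiv.swap_apply_def]
    split_ifs <;> omega

/-- `g` fixes every number above `n`. -/
def FixesAbove (n : ℕ) (g : Equiv.Perm ℕ) : Prop := ∀ x, n < x → g x = x

theorem FixesAbove.le {n : ℕ} {g : Equiv.Perm ℕ} (h : FixesAbove n g) {x : ℕ} (hx : x ≤ n) :
    g x ≤ n := by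
  by_contra! hlt
  have := g.injective (h _ hlt)
  omega

theorem fixesAbove_genPerm {n : ℕ} {L : List ℕ} (hL : ∀ i ∈ L, i ≤ n) :
    FixesAbove n (genPerm L) := by
  induction L with
  | nil => intro x _; rfl
  | cons i L ih =>
    intro x hx
    have hi := hL i (by simp)
    rw [genPerm_cons, Equiv.Perm.mul_apply, ih (fun j hj => hL j (by simp [hj])) x hx,
      Equiv.swap_apply_of_ne_of_ne] <;> omega

/-- The permutation obtained from `g` and `f` for a path that starts with an arch. -/
def archPerm (k : ℕ) (g f : Equiv.Perm ℕ) : Equiv.Perm ℕ :=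
  shiftPerm k g * genPerm (List.range' 1 k) * f

section archPerm

variable {i x : ℕ} {g f : Equiv.Perm ℕ}

theorem archPerm_apply (k : ℕ) (g f : Equiv.Perm ℕ) (x : ℕ) :
    archPerm k g f x = shiftPerm k g (genPerm (List.range' 1 k) (f x)) := rfl

/-- Together with the next three lemmas this describes `archPerm` entry by entry around the value
`0`. -/
theorem archPerm_apply_of_gt (hf : FixesAbove i f) (hx : i + 1 < x) :
    archPerm (i + 1) g f x = i + 1 + g (x - (i + 1)) := by
  rw [archPerm_apply, hf x (by omega), genPerm_range'_apply, if_neg (by omega),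
    if_neg (by omega), shiftPerm_apply, if_neg (by omega)]

theorem archPerm_apply_self (hf : FixesAbove i f) : archPerm (i + 1) g f (i + 1) = 0 := by
  rw [archPerm_apply, hf _ (by omega), genPerm_range'_apply, if_neg (by omega),
    if_pos rfl, shiftPerm_apply, if_pos (by omega)]

theorem archPerm_apply_of_lt (hx : f x < i) : archPerm (i + 1) g f x = f x + 1 := by
  rw [archPerm_apply, genPerm_range'_apply, if_pos (by omega), shiftPerm_apply,
    if_pos (by omega)]

theorem archPerm_apply_of_eq (hx : f x = i) : archPerm (i + 1) g f x = i + 1 + g 0 := by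
  rw [archPerm_apply, genPerm_range'_apply, if_pos (by omega), shiftPerm_apply,
    if_neg (by omega), hx, Nat.sub_self]

end archPerm

/-! ### The permutation of a path -/

/-- The letters of the words of a path, in the order in which they are applied. -/
noncomputable def pathLetters (n : ℕ) (p : Path) : List ℕ := (pathWords n p).flatMap List.reverse

/-- The permutation of positions given by the words of a path. -/
noncomputable def pathPerm (n : ℕ) (p : Path) : Equiv.Perm ℕ := genPerm (pathLetters n p)

theorem flatMap_reverse_map_map (c : ℕ) (L : List (List ℕ)) :
    (L.map (List.map (· + c))).flatMap List.reverse = (L.flatMap List.reverse).map (· + c) := by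
  induction L with
  | nil => rfl
  | cons a L ih => simp [List.flatMap_cons, ih]

theorem pathLetters_level {n : ℕ} {p : Path} (hp : Decomposed n p) :
    pathLetters (n + 1) (Step.e :: p) = (pathLetters n p).map (· + 1) := by
  rw [pathLetters, pathWords_level hp, flatMap_reverse_map_map, pathLetters]

theorem pathLetters_arch {i m : ℕ} {p q : Path} (hp : Decomposed i p) (hq : Decomposed m q) :
    pathLetters (i + m + 1) (Step.u :: (p ++ Step.d :: q)) =
      (pathLetters m q).map (· + (i + 1)) ++ (List.range' 1 (i + 1) ++ pathLetters i p) := by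
  rw [pathLetters, pathWords_arch hp hq, List.flatMap_append, flatMap_reverse_map_map,
    List.flatMap_cons, List.reverse_reverse, pathLetters, pathLetters]

theorem Decomposed.pathLetters_bounds {n : ℕ} {p : Path} (hp : Decomposed n p) :
    ∀ l ∈ pathLetters n p, 1 ≤ l ∧ l ≤ n := by
  induction hp with
  | nil => simp [pathLetters, pathWords_nil]
  | level hp ih =>
    intro l hl
    rw [pathLetters_level hp, List.mem_map] at hl
    obtain ⟨l, hl, rfl⟩ := hl
    have := ih l hl
    omega
  | arch hp hq ihp ihq =>
    intro l hl
    rw [pathLetters_arch hp hq, List.mem_append, List.mem_append, List.mem_map,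
      List.mem_range'_1] at hl
    rcases hl with ⟨l, hl, rfl⟩ | hl | hl
    · have := ihq l hl; omega
    · omega
    · have := ihp l hl; omega

theorem pathPerm_nil : pathPerm 0 [] = 1 := by
  simp [pathPerm, pathLetters, pathWords_nil]

theorem pathPerm_level {n : ℕ} {p : Path} (hp : Decomposed n p) :
    pathPerm (n + 1) (Step.e :: p) = shiftPerm 1 (pathPerm n p) := by
  rw [pathPerm, pathLetters_level hp, genPerm_map_add fun l hl => (hp.pathLetters_bounds l hl).1,
    pathPerm]

theorem pathPerm_arch {i m : ℕ} {p q : Path} (hp : Decomposed i p) (hq : Decomposed m q) :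
    pathPerm (i + m + 1) (Step.u :: (p ++ Step.d :: q)) =
      archPerm (i + 1) (pathPerm m q) (pathPerm i p) := by
  rw [pathPerm, pathLetters_arch hp hq, genPerm_append, genPerm_append,
    genPerm_map_add fun l hl => (hq.pathLetters_bounds l hl).1, archPerm, mul_assoc, pathPerm,
    pathPerm]

theorem Decomposed.fixesAbove {n : ℕ} {p : Path} (hp : Decomposed n p) :
    FixesAbove n (pathPerm n p) :=
  fixesAbove_genPerm fun l hl => (hp.pathLetters_bounds l hl).2

/-- Generators act on positions, hence multiply on the right, and their product can be computed in
permutations of `ℕ`, independently of `n`. -/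
theorem foldl_applyGen {n : ℕ} {L : List ℕ} (hL : ∀ l ∈ L, 1 ≤ l ∧ l ≤ n) :
    ∀ (π : Equiv.Perm (Fin (n + 1))) (x : Fin (n + 1)), ∃ h : genPerm L x < n + 1,
      L.foldl (fun π i => applyGen i π) π x = π ⟨genPerm L x, h⟩ := by
  induction L with
  | nil => intro π x; exact ⟨x.2, rfl⟩
  | cons i L ih =>
    intro π x
    have hi := hL i (by simp)
    obtain ⟨h, hx⟩ := ih (fun l hl => hL l (by simp [hl])) (applyGen i π) x
    have key : (Equiv.swap (⟨i - 1, by omega⟩ : Fin (n + 1)) ⟨i, by omega⟩ ⟨genPerm L x, h⟩).val =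
        genPerm (i :: L) x := by
      rw [genPerm_cons, Equiv.Perm.mul_apply, Equiv.swap_apply_def, Equiv.swap_apply_def]
      simp only [Fin.mk.injEq]
      split_ifs <;> rfl
    refine ⟨key ▸ Fin.isLt _, ?_⟩
    rw [List.foldl_cons, hx, applyGen, dif_pos (by omega), Equiv.Perm.mul_apply]
    exact congrArg π (Fin.ext key)

theorem Decomposed.phi_apply {n : ℕ} {p : Path} (hp : Decomposed n p) (x : Fin (n + 1)) :
    (phi n p x).val = n - pathPerm n p x := by
  have h1 : phi n p = (pathLetters n p).foldl (fun π i => applyGen i π) Fin.revPerm := by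
    rw [pathLetters, List.foldl_flatMap]
    simp only [phi, pathWords, applyWord, List.foldl_reverse]
  obtain ⟨h, hx⟩ := foldl_applyGen hp.pathLetters_bounds Fin.revPerm x
  rw [h1, hx, Fin.revPerm_apply, Fin.val_rev]
  simp only [pathPerm]
  omega

/-! ### Pattern avoidance -/

/-- `n - g` avoids `1243` and `2143`. -/
def Avoids (g : Equiv.Perm ℕ) : Prop :=
  ∀ a b c d, a < b → b < c → c < d → g c < g d → g d < g a → g d < g b → False

/-- A fixed entry below `k` is smaller than all later entries, so it cannot open a forbidden
pattern. -/
theorem avoids_shiftPerm {k : ℕ} {g : Equiv.Perm ℕ} (hg : Avoids g) :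
    Avoids (shiftPerm k g) := by
  intro a b c d hab hbc hcd h1 h2 h3
  by_cases ha : a < k
  · rw [shiftPerm_apply, shiftPerm_apply k g a] at h2
    split_ifs at h2 <;> omega
  · obtain ⟨a, rfl⟩ := Nat.exists_eq_add_of_le' (not_lt.1 ha)
    obtain ⟨b, rfl⟩ := Nat.exists_eq_add_of_le' (show k ≤ b by omega)
    obtain ⟨c, rfl⟩ := Nat.exists_eq_add_of_le' (show k ≤ c by omega)
    obtain ⟨d, rfl⟩ := Nat.exists_eq_add_of_le' (show k ≤ d by omega)
    simp only [shiftPerm_apply_add] at h1 h2 h3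
    exact hg a b c d (by omega) (by omega) (by omega) (by omega) (by omega) (by omega)

theorem Avoids.of_shiftPerm {k : ℕ} {g : Equiv.Perm ℕ} (hg : Avoids (shiftPerm k g)) :
    Avoids g := by
  intro a b c d hab hbc hcd h1 h2 h3
  refine hg (a + k) (b + k) (c + k) (d + k) (by omega) (by omega) (by omega) ?_ ?_ ?_ <;>
    simp only [shiftPerm_apply_add] <;> omega

theorem archPerm_lt {i x : ℕ} {g f : Equiv.Perm ℕ} (hf : FixesAbove i f) (hx : x ≤ i) :
    archPerm (i + 1) g f x = f x + 1 ∧ f x < i ∨ archPerm (i + 1) g f x = i + 1 + g 0 ∧ f x = i := by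
  rcases (hf.le hx).lt_or_eq with h | h
  · exact Or.inl ⟨archPerm_apply_of_lt h, h⟩
  · exact Or.inr ⟨archPerm_apply_of_eq h, h⟩

/-- Only `c` can be the position of the value `0`. A pattern ending before it lies in `f`; any other
comes from `g`. -/
theorem avoids_archPerm {i : ℕ} {g f : Equiv.Perm ℕ} (hf : FixesAbove i f) (hfa : Avoids f)
    (hga : Avoids g) : Avoids (archPerm (i + 1) g f) := by
  intro a b c d hab hbc hcd h1 h2 h3
  have hself := archPerm_apply_self (g := g) hf
  have hd : d ≠ i + 1 := by rintro rfl; omega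
  have hb : b ≠ i + 1 := by rintro rfl; omega
  have ha : a ≠ i + 1 := by rintro rfl; omega
  by_cases hdi : d ≤ i
  · refine hfa a b c d hab hbc hcd ?_ ?_ ?_ <;>
      have := archPerm_lt (g := g) hf (show a ≤ i by omega) <;>
      have := archPerm_lt (g := g) hf (show b ≤ i by omega) <;>
      have := archPerm_lt (g := g) hf (show c ≤ i by omega) <;>
      have := archPerm_lt (g := g) hf hdi <;> omega
  have gd := archPerm_apply_of_gt (g := g) hf (show i + 1 < d by omega)
  by_cases hbi : b ≤ i
  · have ga := archPerm_lt (g := g) hf (show a ≤ i by omega)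
    have gb := archPerm_lt (g := g) hf hbi
    -- The value at `d` is at least `i + 1`, and only one position up to `i` carries so large a
    -- value.
    have : f a = f b := by omega
    have := f.injective this
    omega
  have gb := archPerm_apply_of_gt (g := g) hf (show i + 1 < b by omega)
  have gc := archPerm_apply_of_gt (g := g) hf (show i + 1 < c by omega)
  by_cases hai : a ≤ i
  · have ga := archPerm_lt (g := g) hf hai
    -- The value at `a` must be `i + 1 + g 0`, so position `0` of `g` plays the part of `a`.
    exact hga 0 (b - (i + 1)) (c - (i + 1)) (d - (i + 1)) (by omega) (by omega) (by omega)
      (by omega) (by omega) (by omega)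
  · have ga := archPerm_apply_of_gt (g := g) hf (show i + 1 < a by omega)
    exact hga (a - (i + 1)) (b - (i + 1)) (c - (i + 1)) (d - (i + 1)) (by omega) (by omega)
      (by omega) (by omega) (by omega) (by omega)

theorem Decomposed.avoids {n : ℕ} {p : Path} (hp : Decomposed n p) : Avoids (pathPerm n p) := by
  induction hp with
  | nil =>
    rw [pathPerm_nil]
    intro a b c d _ _ _ _ h _
    simp only [Equiv.Perm.one_apply] at h
    omega
  | level hp ih => rw [pathPerm_level hp]; exact avoids_shiftPerm ih
  | arch hp hq ihp ihq => rw [pathPerm_arch hp hq]; exact avoids_archPerm hp.fixesAbove ihp ihq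

/-! ### Recovering the path from its permutation. -/

theorem archPerm_inj {i i' : ℕ} {g g' f f' : Equiv.Perm ℕ} (hf : FixesAbove i f)
    (hf' : FixesAbove i' f') (h : archPerm (i + 1) g f = archPerm (i' + 1) g' f') :
    i = i' ∧ g = g' ∧ f = f' := by
  have h1 : i = i' := by
    have h2 := archPerm_apply_self (g := g) hf
    rw [h, ← archPerm_apply_self (g := g') hf'] at h2
    have := (archPerm (i' + 1) g' f').injective h2
    omega
  subst h1
  -- Before the value `0`, an entry at most `i` is `f x + 1`, and a larger entry marks `f x = i`.
  have h2 : f = f' := by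
    ext x
    by_cases hx : x ≤ i
    · have h3 := archPerm_lt (g := g) hf hx
      have h4 := archPerm_lt (g := g') hf' hx
      rw [h] at h3
      omega
    · rw [hf x (by omega), hf' x (by omega)]
  subst h2
  rw [archPerm, archPerm, mul_left_inj, mul_left_inj] at h
  exact ⟨rfl, shiftPerm_injective _ h, rfl⟩

theorem shiftPerm_one_ne_archPerm {i : ℕ} {g g' f : Equiv.Perm ℕ} (hf : FixesAbove i f) :
    shiftPerm 1 g' ≠ archPerm (i + 1) g f := by
  intro h
  have h1 : shiftPerm 1 g' 0 = 0 := by simp [shiftPerm_apply]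
  rw [h] at h1
  have := (archPerm (i + 1) g f).injective (h1.trans (archPerm_apply_self hf).symm)
  omega

theorem Decomposed.pathPerm_inj {n : ℕ} {p : Path} (hp : Decomposed n p) :
    ∀ {n' : ℕ} {q : Path}, Decomposed n' q → n = n' → pathPerm n p = pathPerm n' q → p = q := by
  induction hp with
  | nil =>
    intro n' q hq hn h
    cases hq with
    | nil => rfl
    | level _ => omega
    | arch _ _ => omega
  | level hp ih =>
    intro n' q hq hn h
    cases hq with
    | nil => omega
    | level hq =>
      rw [pathPerm_level hp, pathPerm_level hq] at h
      rw [ih hq (by omega) (shiftPerm_injective _ h)]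
    | arch hq hq' =>
      rw [pathPerm_level hp, pathPerm_arch hq hq'] at h
      exact absurd h (shiftPerm_one_ne_archPerm hq.fixesAbove)
  | arch hp hp' ih ih' =>
    intro n' q hq hn h
    cases hq with
    | nil => omega
    | level hq =>
      rw [pathPerm_level hq, pathPerm_arch hp hp'] at h
      exact absurd h.symm (shiftPerm_one_ne_archPerm hp.fixesAbove)
    | arch hq hq' =>
      rw [pathPerm_arch hp hp', pathPerm_arch hq hq'] at h
      obtain ⟨h1, h2, h3⟩ := archPerm_inj hp.fixesAbove hq.fixesAbove h
      rw [ih hq h1 h3, ih' hq' (by omega) h2]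

theorem exists_perm_of_injOn {k : ℕ} {f : ℕ → ℕ} (hf : ∀ x < k, f x < k)
    (hinj : ∀ x < k, ∀ y < k, f x = f y → x = y) :
    ∃ F : Equiv.Perm ℕ, (∀ x < k, F x = f x) ∧ ∀ x, k ≤ x → F x = x := by
  let F : ℕ → ℕ := fun x => if x < k then f x else x
  have hF1 : ∀ x < k, F x = f x := fun x hx => if_pos hx
  have hF2 : ∀ x, k ≤ x → F x = x := fun x hx => if_neg (by omega)
  have hFi : Function.Injective F := by
    intro x y h
    rcases lt_or_ge x k with hx | hx <;> rcases lt_or_ge y k with hy | hy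
    · rw [hF1 x hx, hF1 y hy] at h
      exact hinj x hx y hy h
    · rw [hF1 x hx, hF2 y hy] at h
      have := hf x hx
      omega
    · rw [hF2 x hx, hF1 y hy] at h
      have := hf y hy
      omega
    · rwa [hF2 x hx, hF2 y hy] at h
  have hFs : Function.Surjective F := by
    intro y
    rcases lt_or_ge y k with hy | hy
    · have hmaps : Set.MapsTo F (Finset.range k : Set ℕ) (Finset.range k : Set ℕ) := by
        intro x hx
        simp only [Finset.coe_range, Set.mem_Iio] at hx ⊢
        rw [hF1 x hx]
        exact hf x hx
      obtain ⟨x, -, hx⟩ := Finset.surjOn_of_injOn_of_card_le F hmaps hFi.injOn le_rfl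
        (Finset.mem_coe.2 (Finset.mem_range.2 hy))
      exact ⟨x, hx⟩
    · exact ⟨y, hF2 y hy⟩
  exact ⟨Equiv.ofBijective F ⟨hFi, hFs⟩, hF1, hF2⟩

/-- Before the position `k` of `0`, at most one entry of an avoiding permutation is at
least `k`. -/
theorem Avoids.eq_of_large {k : ℕ} {g : Equiv.Perm ℕ} (hg : Avoids g) (hk : g k = 0) {a b : ℕ}
    (ha : a < k) (hb : b < k) (hga : k ≤ g a) (hgb : k ≤ g b) : a = b := by
  wlog hab : a < b generalizing a b
  · rcases (not_lt.1 hab).lt_or_eq with h | h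
    · exact (this hb ha hgb hga h).symm
    · exact h.symm
  exfalso
  -- Otherwise the `k - 1` values `1, …, k - 1` would share the `k - 2` positions before `k` other
  -- than `a` and `b`. Such a `v` completes a pattern with `a`, `b` and the `0` at `k`.
  obtain ⟨v, hv, hv'⟩ : ∃ v, v ∈ Finset.Ico 1 k ∧ k ≤ g.symm v := by
    by_contra! H
    have hsub : (Finset.Ico 1 k).image g.symm ⊆ ((Finset.range k).erase a).erase b := by
      intro x hx
      obtain ⟨v, hv, rfl⟩ := Finset.mem_image.1 hx
      have hlt := H v hv
      rw [Finset.mem_Ico] at hv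
      simp only [Finset.mem_erase, Finset.mem_range]
      refine ⟨?_, ?_, hlt⟩
      · rintro rfl; rw [Equiv.apply_symm_apply] at hgb; omega
      · rintro rfl; rw [Equiv.apply_symm_apply] at hga; omega
    have hcard := Finset.card_le_card hsub
    rw [Finset.card_image_of_injective _ g.symm.injective, Finset.card_erase_of_mem,
      Finset.card_erase_of_mem, Finset.card_range, Nat.card_Ico] at hcard
    · omega
    · simpa using ha
    · simp only [Finset.mem_erase, Finset.mem_range]; omega
  rw [Finset.mem_Ico] at hv
  have hne : g.symm v ≠ k := by
    rintro h
    rw [← h, Equiv.apply_symm_apply] at hk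
    omega
  refine hg a b k (g.symm v) hab hb (by omega) ?_ ?_ ?_ <;> rw [Equiv.apply_symm_apply] <;> omega

/-- The entries before the `0` determine `f` up to order isomorphism; `g` is what remains after
cancelling `f` and the cycle. -/
theorem Avoids.exists_eq_archPerm {i n : ℕ} {h : Equiv.Perm ℕ} (hh : Avoids h)
    (hn : FixesAbove n h) (hk : h (i + 1) = 0) :
    ∃ m g f, n = i + m + 1 ∧ FixesAbove i f ∧ FixesAbove m g ∧ Avoids f ∧ Avoids g ∧
      h = archPerm (i + 1) g f := by
  have hin : i + 1 ≤ n := by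
    by_contra! hlt
    have := hn _ hlt
    omega
  have hpos : ∀ x, x ≠ i + 1 → 0 < h x := by
    intro x hx
    rcases Nat.eq_zero_or_pos (h x) with h0 | h0
    · rw [← hk] at h0
      exact absurd (h.injective h0) hx
    · exact h0
  -- An entry too large for `f` is sent to the top value `i`; `Avoids.eq_of_large` makes this
  -- injective.
  obtain ⟨f, hf, hf'⟩ := exists_perm_of_injOn (k := i + 1)
    (f := fun x => if h x < i + 1 then h x - 1 else i)
    (fun x hx => by split_ifs <;> omega)
    (fun x hx y hy hxy => by
      have h1 := hpos x (by omega)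
      have h2 := hpos y (by omega)
      split_ifs at hxy with h3 h4 h4
      · exact h.injective (by omega)
      · omega
      · omega
      · exact hh.eq_of_large hk hx hy (by omega) (by omega))
  have hfA : FixesAbove i f := fun x hx => hf' x hx
  have hf1 : ∀ x, x ≤ i → (h x < i + 1 ∧ f x = h x - 1) ∨ (i + 1 ≤ h x ∧ f x = i) := by
    intro x hx
    have := hf x (by omega)
    split_ifs at this <;> omega
  obtain ⟨g, hg⟩ := exists_eq_shiftPerm (k := i + 1)
    (h := h * f⁻¹ * (genPerm (List.range' 1 (i + 1)))⁻¹) (by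
      intro y hy
      obtain ⟨x, rfl⟩ : ∃ x, (genPerm (List.range' 1 (i + 1)) * f) x = y := Equiv.surjective _ y
      have : (h * f⁻¹ * (genPerm (List.range' 1 (i + 1)))⁻¹)
          ((genPerm (List.range' 1 (i + 1)) * f) x) = h x := by simp
      rw [this]
      rw [Equiv.Perm.mul_apply, genPerm_range'_apply] at hy ⊢
      rcases lt_trichotomy x (i + 1) with hx | rfl | hx
      · have h1 := hf1 x (by omega)
        have h2 := hpos x (by omega)
        split_ifs at hy ⊢ <;> omega
      · rw [hf' _ le_rfl, hk]
        simp
      · rw [hf' x hx.le] at hy ⊢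
        split_ifs at hy ⊢ <;> omega)
  have heq : h = archPerm (i + 1) g f := by
    rw [archPerm, ← hg]
    simp
  obtain ⟨m, rfl⟩ : ∃ m, n = i + m + 1 := ⟨n - i - 1, by omega⟩
  have hgt : ∀ x, 0 < x → h (x + (i + 1)) = i + 1 + g x := by
    intro x hx
    have := archPerm_apply_of_gt (g := g) hfA (show i + 1 < x + (i + 1) by omega)
    rw [heq, this, Nat.add_sub_cancel]
  refine ⟨m, g, f, rfl, hfA, ?_, ?_, ?_, heq⟩
  · intro x hx
    have h1 := hgt x (by omega)
    rw [hn _ (by omega)] at h1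
    omega
  · intro a b c d hab hbc hcd h1 h2 h3
    have hd : d ≤ i := by
      by_contra! hlt
      rw [hfA d hlt] at h2
      rcases le_or_gt a i with ha | ha
      · have := hfA.le ha; omega
      · rw [hfA a ha] at h2; omega
    have ha := hf1 a (by omega)
    have hb := hf1 b (by omega)
    have hc := hf1 c (by omega)
    have hd' := hf1 d hd
    have := hpos c (by omega)
    have := hpos d (by omega)
    have := hfA.le (show a ≤ i by omega)
    exact hh a b c d hab hbc hcd (by omega) (by omega) (by omega)
  · intro a b c d hab hbc hcd h1 h2 h3
    -- The value `g 0` shows up in `h` before the `0`, at the position where `f` takes the value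
    -- `i`.
    obtain ⟨a', ha', ha''⟩ : ∃ a', a' < b + (i + 1) ∧ h a' = i + 1 + g a := by
      rcases Nat.eq_zero_or_pos a with rfl | ha
      · have h4 : f (f.symm i) = i := f.apply_symm_apply i
        refine ⟨f.symm i, ?_, by rw [heq, archPerm_apply_of_eq h4]⟩
        by_contra! hle
        rw [hfA _ (by omega)] at h4
        omega
      · exact ⟨a + (i + 1), by omega, hgt a ha⟩
    have hb := hgt b (by omega)
    have hc := hgt c (by omega)
    have hd := hgt d (by omega)
    exact hh a' (b + (i + 1)) (c + (i + 1)) (d + (i + 1)) ha' (by omega) (by omega)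
      (by omega) (by omega) (by omega)

/-- The position of the value `0` dictates the first step: `e` (or the empty path) at position `0`,
and `u` otherwise. -/
theorem Avoids.exists_path {n : ℕ} : ∀ {h : Equiv.Perm ℕ}, Avoids h → FixesAbove n h →
    ∃ p, Decomposed n p ∧ pathPerm n p = h := by
  induction n using Nat.strong_induction_on with
  | _ n ih =>
    intro h hh hn
    rcases hk : h.symm 0 with _ | i
    · have h0 : h 0 = 0 := by rw [← hk, Equiv.apply_symm_apply, hk]
      rcases n with _ | n
      · refine ⟨[], .nil, ?_⟩
        rw [pathPerm_nil]
        ext x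
        rcases Nat.eq_zero_or_pos x with rfl | hx
        · exact h0.symm
        · exact (hn x hx).symm
      · obtain ⟨g, rfl⟩ := exists_eq_shiftPerm (k := 1) (h := h)
          (fun x hx => by obtain rfl : x = 0 := by omega
                          exact h0)
        obtain ⟨p, hp, hpg⟩ := ih n (by omega) (Avoids.of_shiftPerm hh) (fun x hx => by
          have := hn (x + 1) (by omega)
          rw [shiftPerm_apply_add] at this
          omega)
        exact ⟨_, hp.level, by rw [pathPerm_level hp, hpg]⟩
    · have h0 : h (i + 1) = 0 := by rw [← hk, Equiv.apply_symm_apply]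
      obtain ⟨m, g, f, rfl, hf, hg, hfa, hga, rfl⟩ := hh.exists_eq_archPerm hn h0
      obtain ⟨p, hp, rfl⟩ := ih i (by omega) hfa hf
      obtain ⟨q, hq, rfl⟩ := ih m (by omega) hga hg
      exact ⟨_, hp.arch hq, pathPerm_arch hp hq⟩

/-! ### The map `phi` is a bijection -/

/-- The two patterns differ only in the order of their first two entries, which `Avoids` leaves
free; the complement reverses the inequalities. -/
theorem mem_schroderPerms_iff {n : ℕ} {π : Equiv.Perm (Fin (n + 1))} {g : Equiv.Perm ℕ}
    (hg : FixesAbove n g) (h : ∀ x : Fin (n + 1), (π x).val = n - g x) :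
    π ∈ schroderPerms (n + 1) ↔ Avoids g := by
  constructor
  · rintro ⟨h1, h2⟩ a b c d hab hbc hcd hcd' hda hdb
    have hd : d ≤ n := by
      by_contra! hlt
      rw [hg d hlt] at hda
      rcases le_or_gt a n with ha | ha
      · have := hg.le ha; omega
      · rw [hg a ha] at hda; omega
    have ha' := hg.le (show a ≤ n by omega)
    have hb' := hg.le (show b ≤ n by omega)
    have hc' := hg.le (show c ≤ n by omega)
    have hd' := hg.le hd
    have hmono : StrictMono (![⟨a, by omega⟩, ⟨b, by omega⟩, ⟨c, by omega⟩, ⟨d, by omega⟩] :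
        Fin 4 → Fin (n + 1)) := by
      intro u v huv
      fin_cases u <;> fin_cases v <;> simp at huv ⊢ <;> omega
    have hne : g a ≠ g b := fun he => by have := g.injective he; omega
    rcases hne.lt_or_gt with hlt | hlt
    · refine h2 ⟨_, hmono, fun u v => ?_⟩
      fin_cases u <;> fin_cases v <;> simp [Fin.lt_def, h] <;> omega
    · refine h1 ⟨_, hmono, fun u v => ?_⟩
      fin_cases u <;> fin_cases v <;> simp [Fin.lt_def, h] <;> omega
  · intro H
    constructor
    · rintro ⟨f, hf, hfp⟩
      have h01 := Fin.lt_def.1 (hf (show (0 : Fin 4) < 1 by decide))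
      have h12 := Fin.lt_def.1 (hf (show (1 : Fin 4) < 2 by decide))
      have h23 := Fin.lt_def.1 (hf (show (2 : Fin 4) < 3 by decide))
      have p1 := Fin.lt_def.1 ((hfp 3 2).2 (by decide))
      have p2 := Fin.lt_def.1 ((hfp 0 3).2 (by decide))
      have p3 := Fin.lt_def.1 ((hfp 1 3).2 (by decide))
      simp only [h] at p1 p2 p3
      exact H _ _ _ _ h01 h12 h23 (by omega) (by omega) (by omega)
    · rintro ⟨f, hf, hfp⟩
      have h01 := Fin.lt_def.1 (hf (show (0 : Fin 4) < 1 by decide))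
      have h12 := Fin.lt_def.1 (hf (show (1 : Fin 4) < 2 by decide))
      have h23 := Fin.lt_def.1 (hf (show (2 : Fin 4) < 3 by decide))
      have p1 := Fin.lt_def.1 ((hfp 3 2).2 (by decide))
      have p2 := Fin.lt_def.1 ((hfp 0 3).2 (by decide))
      have p3 := Fin.lt_def.1 ((hfp 1 3).2 (by decide))
      simp only [h] at p1 p2 p3
      exact H _ _ _ _ h01 h12 h23 (by omega) (by omega) (by omega)

theorem exists_fixesAbove {n : ℕ} (π : Equiv.Perm (Fin (n + 1))) :
    ∃ g : Equiv.Perm ℕ, FixesAbove n g ∧ ∀ x : Fin (n + 1), (π x).val = n - g x := by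
  refine ⟨(Fin.revPerm * π).extendDomain (Fin.equivSubtype (n := n + 1)), fun x hx => ?_,
    fun x => ?_⟩
  · exact Equiv.Perm.extendDomain_apply_not_subtype _ _ (by omega)
  · have := Equiv.Perm.extendDomain_apply_image (Fin.revPerm * π)
      (Fin.equivSubtype (n := n + 1)) x
    simp only [Fin.equivSubtype_apply] at this
    rw [this]
    simp [Fin.val_rev]
    omega

theorem phi_bijOn (n : ℕ) :
    Set.BijOn (phi n) {p | IsSchroderPath n p} (schroderPerms (n + 1)) := by
  simp only [isSchroderPath_iff_decomposed]
  refine ⟨fun p hp => ?_, fun p hp q hq h => ?_, fun π hπ => ?_⟩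
  · exact (mem_schroderPerms_iff hp.fixesAbove hp.phi_apply).2 hp.avoids
  · rw [Set.mem_ofPred_eq] at hp hq
    refine hp.pathPerm_inj hq rfl (Equiv.ext fun x => ?_)
    by_cases hx : x ≤ n
    · have h1 := hp.phi_apply ⟨x, by omega⟩
      have h2 := hq.phi_apply ⟨x, by omega⟩
      have h3 := hp.fixesAbove.le hx
      have h4 := hq.fixesAbove.le hx
      rw [h] at h1
      dsimp only at h1 h2
      omega
    · rw [hp.fixesAbove x (by omega), hq.fixesAbove x (by omega)]
  · obtain ⟨g, hg, hgπ⟩ := exists_fixesAbove π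
    obtain ⟨p, hp, rfl⟩ := ((mem_schroderPerms_iff hg hgπ).1 hπ).exists_path hg
    exact ⟨p, hp, Equiv.ext fun x => Fin.ext (by rw [hp.phi_apply, hgπ])⟩

/-! ### Distances -/

/-- The number of places up to `n` in which two permutations differ. -/
def natDist (n : ℕ) (g h : Equiv.Perm ℕ) : ℕ :=
  ((Finset.range (n + 1)).filter fun x => g x ≠ h x).card

theorem permDist_phi_le {n : ℕ} {p q : Path} (hp : Decomposed n p) (hq : Decomposed n q) :
    permDist (phi n p) (phi n q) ≤ natDist n (pathPerm n p) (pathPerm n q) := by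
  rw [permDist, hammingDist, natDist]
  refine Finset.card_le_card_of_injOn Fin.val (fun x hx => ?_) Fin.val_injective.injOn
  simp only [Finset.coe_filter, Finset.mem_univ, true_and, Set.mem_ofPred_eq] at hx
  simp only [Finset.coe_filter, Finset.mem_range, Set.mem_ofPred_eq]
  refine ⟨x.2, fun h => hx (Fin.ext ?_)⟩
  rw [hp.phi_apply, hq.phi_apply, h]

theorem wordDist_comm {α : Type*} [DecidableEq α] (v w : List α) :
    wordDist v w = wordDist w v := by
  simp only [wordDist, max_comm v.length, ne_comm (a := v[_]?)]

theorem wordDist_le_length {α : Type*} [DecidableEq α] {v w : List α}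
    (h : v.length = w.length) : wordDist v w ≤ v.length := by
  refine (Finset.card_filter_le _ _).trans ?_
  simp [h]

/-- Equal lengths keep the common suffix aligned. -/
theorem wordDist_append_append_le {α : Type*} [DecidableEq α] (a b : List α) {v w : List α}
    (h : v.length = w.length) : wordDist (a ++ (v ++ b)) (a ++ (w ++ b)) ≤ wordDist v w := by
  have hsub : (Finset.range (max (a ++ (v ++ b)).length (a ++ (w ++ b)).length)).filter
      (fun i => (a ++ (v ++ b))[i]? ≠ (a ++ (w ++ b))[i]?) ⊆
      ((Finset.range (max v.length w.length)).filter (fun i => v[i]? ≠ w[i]?)).image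
        (· + a.length) := by
    intro x hx
    rw [Finset.mem_filter] at hx
    have h2 := hx.2
    rcases lt_or_ge x a.length with h3 | h3
    · simp [List.getElem?_append, h3] at h2
    rw [List.getElem?_append_right h3, List.getElem?_append_right h3] at h2
    rcases lt_or_ge (x - a.length) v.length with h4 | h4
    · rw [List.getElem?_append_left h4, List.getElem?_append_left (h ▸ h4)] at h2
      refine Finset.mem_image.2 ⟨x - a.length, ?_, by omega⟩
      rw [Finset.mem_filter, Finset.mem_range]
      exact ⟨lt_max_of_lt_left h4, h2⟩
    · rw [List.getElem?_append_right h4, List.getElem?_append_right (h ▸ h4), h] at h2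
      exact absurd rfl h2
  exact (Finset.card_le_card hsub).trans Finset.card_image_le

theorem length_flatMap_expand (p : Path) : (p.flatMap Step.expand).length = totalWidth p := by
  induction p with
  | nil => rfl
  | cons s p ih => cases s <;> simp [List.flatMap_cons, ih, Step.expand, Step.width] <;> omega

theorem pathDist_append_append_le (a b : Path) {v w : Path} (h : totalWidth v = totalWidth w) :
    pathDist (a ++ (v ++ b)) (a ++ (w ++ b)) ≤ pathDist v w := by
  simp only [pathDist, List.flatMap_append]
  exact wordDist_append_append_le _ _ (by simpa only [length_flatMap_expand] using h)

theorem pathDist_le_totalWidth {p q : Path} (a v w b : Path) (hp : p = a ++ (v ++ b))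
    (hq : q = a ++ (w ++ b)) (h : totalWidth v = totalWidth w) : pathDist p q ≤ totalWidth v := by
  subst hp hq
  refine (pathDist_append_append_le a b h).trans ?_
  rw [pathDist, ← length_flatMap_expand]
  exact wordDist_le_length (by simpa only [length_flatMap_expand] using h)

/-- Both the paths and their permutations are at distance at most `5`. -/
def Close (n : ℕ) (p q : Path) : Prop :=
  pathDist p q ≤ 5 ∧ natDist n (pathPerm n p) (pathPerm n q) ≤ 5

/-- Needed because `orient` may reverse a list. -/
theorem Close.symm {n : ℕ} {p q : Path} (h : Close n p q) : Close n q p := by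
  refine ⟨by rw [pathDist, wordDist_comm]; exact h.1, ?_⟩
  have := h.2
  simp only [natDist] at this ⊢
  simpa only [ne_comm] using this

theorem Close.level {n : ℕ} {p q : Path} (hp : Decomposed n p) (hq : Decomposed n q)
    (h : Close n p q) : Close (n + 1) (Step.e :: p) (Step.e :: q) := by
  constructor
  · have := pathDist_append_append_le [Step.e] [] (hp.totalWidth_eq.trans hq.totalWidth_eq.symm)
    simp only [List.append_nil, List.cons_append, List.nil_append] at this
    exact this.trans h.1
  · refine le_trans ?_ h.2
    rw [pathPerm_level hp, pathPerm_level hq]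
    refine Finset.card_le_card_of_injOn (· - 1) (fun x hx => ?_) (fun x hx y hy hxy => ?_)
    · rw [Finset.mem_coe, Finset.mem_filter, Finset.mem_range] at hx ⊢
      simp only [shiftPerm_apply] at hx ⊢
      split_ifs at hx <;> omega
    · rw [Finset.mem_coe, Finset.mem_filter] at hx hy
      simp only [shiftPerm_apply] at hx hy hxy
      split_ifs at hx hy <;> omega

/-- The permutations change only in their right factor, so they disagree exactly where those factors
do. -/
theorem Close.arch_left {i m : ℕ} {p p' q : Path} (hp : Decomposed i p) (hp' : Decomposed i p')
    (hq : Decomposed m q) (h : Close i p p') :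
    Close (i + m + 1) (Step.u :: (p ++ Step.d :: q)) (Step.u :: (p' ++ Step.d :: q)) := by
  constructor
  · have := pathDist_append_append_le [Step.u] (Step.d :: q)
      (hp.totalWidth_eq.trans hp'.totalWidth_eq.symm)
    simp only [List.cons_append, List.nil_append] at this
    exact this.trans h.1
  · refine le_trans (Finset.card_le_card fun x hx => ?_) h.2
    rw [pathPerm_arch hp hq, pathPerm_arch hp' hq] at hx
    rw [Finset.mem_filter, Finset.mem_range] at hx ⊢
    rw [archPerm_apply, archPerm_apply] at hx
    have hne : pathPerm i p x ≠ pathPerm i p' x := fun he => hx.2 (by rw [he])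
    refine ⟨?_, hne⟩
    by_contra hlt
    exact hne (by rw [hp.fixesAbove x (by omega), hp'.fixesAbove x (by omega)])

/-- A common right factor merely relocates the disagreements; `r` below is this factor. -/
theorem Close.arch_right {i m : ℕ} {p q q' : Path} (hp : Decomposed i p) (hq : Decomposed m q)
    (hq' : Decomposed m q') (h : Close m q q') :
    Close (i + m + 1) (Step.u :: (p ++ Step.d :: q)) (Step.u :: (p ++ Step.d :: q')) := by
  constructor
  · have := pathDist_append_append_le (Step.u :: (p ++ [Step.d])) []
      (hq.totalWidth_eq.trans hq'.totalWidth_eq.symm)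
    simp only [List.cons_append, List.append_assoc, List.nil_append, List.append_nil] at this
    exact this.trans h.1
  · refine le_trans ?_ h.2
    rw [pathPerm_arch hp hq, pathPerm_arch hp hq']
    set r : Equiv.Perm ℕ := genPerm (List.range' 1 (i + 1)) * pathPerm i p with hr
    have hrx : ∀ g x, archPerm (i + 1) g (pathPerm i p) x = shiftPerm (i + 1) g (r x) :=
      fun g x => rfl
    have key : ∀ x, archPerm (i + 1) (pathPerm m q) (pathPerm i p) x ≠
        archPerm (i + 1) (pathPerm m q') (pathPerm i p) x →
        i + 1 ≤ r x ∧ pathPerm m q (r x - (i + 1)) ≠ pathPerm m q' (r x - (i + 1)) := by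
      intro x hx
      rw [hrx, hrx, shiftPerm_apply, shiftPerm_apply] at hx
      split_ifs at hx <;> omega
    refine Finset.card_le_card_of_injOn (fun x => r x - (i + 1)) (fun x hx => ?_)
      (fun x hx y hy hxy => ?_)
    · simp only [Finset.coe_filter, Finset.mem_range, Set.mem_ofPred_eq] at hx ⊢
      have h1 := key x hx.2
      refine ⟨?_, h1.2⟩
      by_contra hlt
      exact h1.2 (by rw [hq.fixesAbove _ (by omega), hq'.fixesAbove _ (by omega)])
    · simp only [Finset.coe_filter, Finset.mem_range, Set.mem_ofPred_eq] at hx hy hxy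
      have h1 := key x hx.2
      have h2 := key y hy.2
      exact r.injective (by omega)

/-- The permutations differ by exchanging the first two entries. -/
theorem close_level_arch {n : ℕ} {p : Path} (hp : Decomposed n p) :
    Close (n + 1) (Step.e :: p) (Step.u :: ([] ++ Step.d :: p)) := by
  constructor
  · refine (pathDist_le_totalWidth [] [Step.e] [Step.u, Step.d] p rfl rfl rfl).trans ?_
    simp [Step.width]
  · have h1 := pathPerm_arch Decomposed.nil hp
    rw [zero_add] at h1
    have h0 : FixesAbove 0 (1 : Equiv.Perm ℕ) := fun x _ => rfl
    rw [pathPerm_level hp, h1, pathPerm_nil]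
    refine le_trans (Finset.card_le_card (t := {0, 1}) fun x hx => ?_)
      (Finset.card_le_two.trans (by norm_num))
    rw [Finset.mem_filter] at hx
    simp only [Finset.mem_insert, Finset.mem_singleton]
    by_contra! hne
    refine hx.2 ?_
    rw [archPerm_apply_of_gt h0 (by omega), shiftPerm_apply, if_neg (by omega)]

/-! ### First and last paths -/

/-- The path `eⁿ`. -/
def flatPath (n : ℕ) : Path := List.replicate n Step.e

/-- The path `u eⁿ⁻¹ d`, and the empty path for `n = 0`. -/
def peakPath : ℕ → Path
  | 0 => []
  | n + 1 => Step.u :: (flatPath n ++ [Step.d])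

theorem flatPath_succ (n : ℕ) : flatPath (n + 1) = Step.e :: flatPath n := rfl

theorem flatPath_succ' (n : ℕ) : flatPath (n + 1) = flatPath n ++ [Step.e] :=
  List.replicate_succ'

theorem decomposed_flatPath : ∀ n, Decomposed n (flatPath n)
  | 0 => .nil
  | n + 1 => (decomposed_flatPath n).level

theorem decomposed_peakPath : ∀ n, Decomposed n (peakPath n)
  | 0 => .nil
  | n + 1 => (decomposed_flatPath n).arch .nil

theorem pathPerm_flatPath (n : ℕ) : pathPerm n (flatPath n) = 1 := by
  induction n with
  | zero => exact pathPerm_nil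
  | succ n ih => rw [flatPath_succ, pathPerm_level (decomposed_flatPath n), ih, shiftPerm_one]

theorem pathPerm_peakPath (n : ℕ) : pathPerm n (peakPath n) = genPerm (List.range' 1 n) := by
  cases n with
  | zero => exact pathPerm_nil
  | succ n =>
    have := pathPerm_arch (decomposed_flatPath n) .nil
    rw [add_zero] at this
    rw [peakPath, this, pathPerm_flatPath, pathPerm_nil, archPerm, shiftPerm_one, one_mul, mul_one]

/-- The first entry of the list of paths, oriented according to the parity of `j`. -/
def endPath (j n : ℕ) : Path := if Odd j then flatPath n else peakPath n

theorem decomposed_endPath (j n : ℕ) : Decomposed n (endPath j n) := by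
  rw [endPath]
  split_ifs
  · exact decomposed_flatPath n
  · exact decomposed_peakPath n

theorem endPath_zero (j : ℕ) : endPath j 0 = [] := by
  rw [endPath]
  split_ifs <;> rfl

theorem pathPerm_endPath_apply (j n x : ℕ) : pathPerm n (endPath j n) x =
    if Odd j then x else if x < n then x + 1 else if x = n then 0 else x := by
  rw [endPath]
  split_ifs with hj h1 h2
  · rw [pathPerm_flatPath]; rfl
  all_goals rw [pathPerm_peakPath, genPerm_range'_apply]
  · rw [if_pos h1]
  · rw [if_neg h1, if_pos h2]
  · rw [if_neg h1, if_neg h2]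

/-- In each parity case the words agree outside a window of width at most `5`. Semilength `0` is
separate because `peakPath 0` has no outer steps. -/
theorem pathDist_endPath_succ (j l i m : ℕ) :
    pathDist (Step.u :: (endPath j i ++ Step.d :: endPath l (m + 1)))
      (Step.u :: (endPath j (i + 1) ++ Step.d :: endPath l m)) ≤ 5 := by
  have width : ∀ (p q a v w b : Path), p = a ++ (v ++ b) → q = a ++ (w ++ b) →
      totalWidth v = totalWidth w → totalWidth v ≤ 5 → pathDist p q ≤ 5 :=
    fun p q a v w b hp hq h h5 => (pathDist_le_totalWidth a v w b hp hq h).trans h5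
  by_cases hj : Odd j <;> by_cases hl : Odd l <;> simp only [endPath, hj, hl, if_true, if_false]
  · exact width _ _ (.u :: flatPath i) [.d, .e] [.e, .d] (flatPath m) (by simp [flatPath_succ])
      (by simp [flatPath_succ']) rfl (by decide)
  · cases m with
    | zero =>
      exact width _ _ (.u :: flatPath i) [.d, .u, .d] [.e, .d] [] (by simp [peakPath, flatPath])
        (by simp [flatPath_succ', peakPath]) rfl (by decide)
    | succ m =>
      exact width _ _ (.u :: flatPath i) [.d, .u, .e] [.e, .d, .u] (flatPath m ++ [.d])
        (by simp [peakPath, flatPath_succ]) (by simp [flatPath_succ', peakPath]) rfl (by decide)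
  · cases i with
    | zero =>
      exact width _ _ [.u] [.d, .e] [.u, .d, .d] (flatPath m)
        (by simp [peakPath, flatPath_succ]) (by simp [flatPath, peakPath]) rfl (by decide)
    | succ i =>
      exact width _ _ (.u :: .u :: flatPath i) [.d, .d, .e] [.e, .d, .d] (flatPath m)
        (by simp [peakPath, flatPath_succ]) (by simp [flatPath_succ', peakPath]) rfl (by decide)
  · cases i with
    | zero =>
      cases m with
      | zero =>
        exact width _ _ [.u] [.d, .u, .d] [.u, .d, .d] [] (by simp [peakPath, flatPath])
          (by simp [flatPath, peakPath]) rfl (by decide)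
      | succ m =>
        exact width _ _ [.u] [.d, .u, .e] [.u, .d, .d, .u] (flatPath m ++ [.d])
          (by simp [peakPath, flatPath_succ]) (by simp [flatPath, peakPath]) rfl (by decide)
    | succ i =>
      cases m with
      | zero =>
        exact width _ _ (.u :: .u :: flatPath i) [.d, .d, .u, .d] [.e, .d, .d] []
          (by simp [peakPath, flatPath]) (by simp [flatPath_succ', peakPath]) rfl (by decide)
      | succ m =>
        exact width _ _ (.u :: .u :: flatPath i) [.d, .d, .u, .e] [.e, .d, .d, .u]
          (flatPath m ++ [.d]) (by simp [peakPath, flatPath_succ])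
          (by simp [flatPath_succ', peakPath]) rfl (by decide)

theorem close_endPath_succ (j l i m : ℕ) :
    Close (i + m + 2) (Step.u :: (endPath j i ++ Step.d :: endPath l (m + 1)))
      (Step.u :: (endPath j (i + 1) ++ Step.d :: endPath l m)) := by
  refine ⟨pathDist_endPath_succ j l i m, ?_⟩
  have h1 := pathPerm_arch (decomposed_endPath j i) (decomposed_endPath l (m + 1))
  have h2 := pathPerm_arch (decomposed_endPath j (i + 1)) (decomposed_endPath l m)
  rw [show i + (m + 1) + 1 = i + m + 2 by omega] at h1
  rw [show i + 1 + m + 1 = i + m + 2 by omega] at h2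
  have f1 := (decomposed_endPath j i).fixesAbove
  have f2 := (decomposed_endPath j (i + 1)).fixesAbove
  rw [h1, h2]
  -- The value `0` moves from `i + 1` to `i + 2`; the inner parts disagree near `i`, and the outer
  -- ones, if peaks, at their last position. For `i = 0` the entry `i - 1` is just `i`.
  refine le_trans (Finset.card_le_card (t := {i - 1, i, i + 1, i + 2, i + m + 2}) fun x hx => ?_)
    Finset.card_le_five
  rw [Finset.mem_filter, Finset.mem_range] at hx
  simp only [Finset.mem_insert, Finset.mem_singleton]
  by_contra! hne
  refine hx.2 ?_
  rcases lt_or_ge x i with hxi | hxi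
  · have e1 := pathPerm_endPath_apply j i x
    have e2 := pathPerm_endPath_apply j (i + 1) x
    rw [archPerm_apply_of_lt, archPerm_apply_of_lt] <;> split_ifs at e1 e2 <;> omega
  · rw [archPerm_apply_of_gt f1 (by omega), archPerm_apply_of_gt f2 (by omega),
      pathPerm_endPath_apply, pathPerm_endPath_apply]
    split_ifs <;> omega

/-! ### The list of paths -/

/-! ### Oriented, numbered and concatenated lists. -/

section orient

variable {α : Type*} {j : ℕ} {L : List α}

theorem mem_orient {x : α} : x ∈ orient j L ↔ x ∈ L := by
  rw [orient]; split_ifs <;> simp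

theorem length_orient : (orient j L).length = L.length := by
  rw [orient]; split_ifs <;> simp

theorem nodup_orient (h : L.Nodup) : (orient j L).Nodup := by
  rw [orient]; split_ifs
  · exact h
  · exact List.nodup_reverse.2 h

theorem isChain_orient {R : α → α → Prop} (hR : ∀ a b, R a b → R b a) (h : L.IsChain R) :
    (orient j L).IsChain R := by
  rw [orient]; split_ifs
  · exact h
  · exact List.isChain_reverse.2 (h.imp hR)

end orient

theorem head?_flatMap_of_head? {α β : Type*} {l : List α} {f : α → List β} {a : α} {b : β}
    (hl : l.head? = some a) (hf : (f a).head? = some b) : (l.flatMap f).head? = some b := by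
  obtain ⟨t, rfl⟩ := List.head?_eq_some_iff.1 hl
  rw [List.flatMap_cons, List.head?_append, hf]
  rfl

theorem getLast?_flatMap_of_getLast? {α β : Type*} {l : List α} {f : α → List β} {a : α} {b : β}
    (hl : l.getLast? = some a) (hf : (f a).getLast? = some b) :
    (l.flatMap f).getLast? = some b := by
  obtain ⟨t, rfl⟩ := List.getLast?_eq_some_iff.1 hl
  simp [List.flatMap_append, List.getLast?_append, hf]

/-- An empty block would make entries of non-neighbouring blocks adjacent, hence `hne`. -/
theorem isChain_flatMap {α β : Type*} {R : β → β → Prop} {l : List α} {f : α → List β}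
    (hne : ∀ a ∈ l, f a ≠ []) (hf : ∀ a ∈ l, (f a).IsChain R)
    (hl : l.IsChain fun a b => ∀ x ∈ (f a).getLast?, ∀ y ∈ (f b).head?, R x y) :
    (l.flatMap f).IsChain R := by
  rw [List.flatMap, List.isChain_flatten]
  · refine ⟨?_, (List.isChain_map f).2 hl⟩
    intro t ht
    obtain ⟨a, ha, rfl⟩ := List.mem_map.1 ht
    exact hf a ha
  · intro ht
    obtain ⟨a, ha, h⟩ := List.mem_map.1 ht
    exact hne a ha h

theorem isChain_zipIdx {α : Type*} {R : α → α → Prop} {l : List α} (k : ℕ) (h : l.IsChain R) :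
    (l.zipIdx k).IsChain fun x y => R x.1 y.1 ∧ y.2 = x.2 + 1 := by
  rw [List.isChain_iff_getElem] at h ⊢
  intro i hi
  simp only [List.length_zipIdx] at hi
  simp only [List.getElem_zipIdx]
  exact ⟨h i hi, by omega⟩

theorem pairwise_zipIdx_fst_ne {α : Type*} {l : List α} (k : ℕ) (h : l.Nodup) :
    (l.zipIdx k).Pairwise fun x y => x.1 ≠ y.1 := by
  have : ((l.zipIdx k).map Prod.fst).Nodup := by rwa [List.zipIdx_map_fst]
  exact List.pairwise_map.1 this

theorem mem_of_mem_zipIdx {α : Type*} {l : List α} {k : ℕ} {x : α × ℕ} (h : x ∈ l.zipIdx k) :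
    x.1 ∈ l := by
  have := List.mem_map_of_mem (f := Prod.fst) h
  rwa [List.zipIdx_map_fst] at this

theorem exists_mem_zipIdx {α : Type*} {l : List α} (k : ℕ) {a : α} (h : a ∈ l) :
    ∃ j, (a, j) ∈ l.zipIdx k := by
  rw [← List.zipIdx_map_fst k l] at h
  obtain ⟨⟨a, j⟩, hj, rfl⟩ := List.mem_map.1 h
  exact ⟨j, hj⟩

/-! ### Blocks of the list: members, repetitions, length. -/

/-- The paths `u a d b` in `pathList (n + 1)` with a fixed part `a`. -/
def innerBlock (n i : ℕ) (aj : Path × ℕ) : List Path :=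
  (orient (aj.2 + B (i + 1) + 1) (pathList (n - i))).map fun b => Step.u :: (aj.1 ++ Step.d :: b)

/-- The paths `u a d b` in `pathList (n + 1)` with `a` of semilength `i`. -/
def block (n i : ℕ) : List Path :=
  ((orient ((n + 1) + (i + 1)) (pathList i)).zipIdx 1).flatMap (innerBlock n i)

theorem pathList_succ (n : ℕ) :
    pathList (n + 1) = (pathList n).map (fun p => Step.e :: p) ++
      (List.range (n + 1)).flatMap (block n) := by
  rw [pathList, ← List.map_coe_finRange_eq_range, List.flatMap_map]
  rfl

theorem B_succ (i : ℕ) : B (i + 2) = B (i + 1) + Nat.largeSchroder i := by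
  simp [B, Finset.sum_range_succ]

theorem mem_innerBlock {n i : ℕ} {aj : Path × ℕ} {p : Path} :
    p ∈ innerBlock n i aj ↔ ∃ b ∈ pathList (n - i), Step.u :: (aj.1 ++ Step.d :: b) = p := by
  simp [innerBlock, mem_orient]

theorem mem_block {n i : ℕ} {p : Path} : p ∈ block n i ↔
    ∃ a ∈ pathList i, ∃ b ∈ pathList (n - i), Step.u :: (a ++ Step.d :: b) = p := by
  simp only [block, List.mem_flatMap, mem_innerBlock]
  constructor
  · rintro ⟨aj, h, hb⟩
    exact ⟨aj.1, mem_orient.1 (mem_of_mem_zipIdx h), hb⟩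
  · rintro ⟨a, ha, hb⟩
    obtain ⟨j, hj⟩ := exists_mem_zipIdx 1 (mem_orient.2 ha)
    exact ⟨(a, j), hj, hb⟩

theorem mem_pathList {n : ℕ} : ∀ {p : Path}, p ∈ pathList n ↔ Decomposed n p := by
  induction n using Nat.strong_induction_on with
  | _ n ih =>
    intro p
    cases n with
    | zero =>
      rw [pathList, List.mem_singleton]
      constructor
      · rintro rfl; exact .nil
      · intro h
        generalize hn : 0 = n at h
        cases h with
        | nil => rfl
        | level _ => omega
        | arch _ _ => omega
    | succ n =>
      simp only [pathList_succ, List.mem_append, List.mem_map, List.mem_flatMap, List.mem_range,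
        mem_block]
      constructor
      · rintro (⟨q, hq, rfl⟩ | ⟨i, hi, a, ha, b, hb, rfl⟩)
        · exact ((ih n (by omega)).1 hq).level
        · have := ((ih i hi).1 ha).arch ((ih (n - i) (by omega)).1 hb)
          rwa [show i + (n - i) + 1 = n + 1 by omega] at this
      · intro h
        generalize hn : n + 1 = k at h
        cases h with
        | nil => omega
        | @level m q hq =>
          obtain rfl : n = m := by omega
          exact Or.inl ⟨q, (ih n (by omega)).2 hq, rfl⟩
        | @arch i m a b ha hb =>
          obtain rfl : n = i + m := by omega
          refine Or.inr ⟨i, by omega, a, (ih i (by omega)).2 ha, b, ?_, rfl⟩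
          rw [Nat.add_sub_cancel_left]
          exact (ih m (by omega)).2 hb

theorem nodup_innerBlock {n i : ℕ} {aj : Path × ℕ} (h : (pathList (n - i)).Nodup) :
    (innerBlock n i aj).Nodup :=
  (nodup_orient h).map fun b b' hb => by simpa using hb

theorem nodup_block {n i : ℕ} (h : (pathList i).Nodup) (h' : (pathList (n - i)).Nodup) :
    (block n i).Nodup := by
  rw [block, List.nodup_flatMap]
  refine ⟨fun aj _ => nodup_innerBlock h', ?_⟩
  refine (pairwise_zipIdx_fst_ne 1 (nodup_orient h)).imp_of_mem ?_
  intro x y hx hy hxy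
  rw [Function.onFun, List.disjoint_left]
  intro p hp hp'
  obtain ⟨b, -, rfl⟩ := mem_innerBlock.1 hp
  obtain ⟨b', -, hb'⟩ := mem_innerBlock.1 hp'
  have h1 := mem_pathList.1 (mem_orient.1 (mem_of_mem_zipIdx hx))
  have h2 := mem_pathList.1 (mem_orient.1 (mem_of_mem_zipIdx hy))
  exact hxy (h1.arch_inj h2 (List.cons.inj hb').2.symm).1

theorem nodup_pathList (n : ℕ) : (pathList n).Nodup := by
  induction n using Nat.strong_induction_on with
  | _ n ih =>
    cases n with
    | zero => simp [pathList]
    | succ n =>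
      rw [pathList_succ, List.nodup_append']
      refine ⟨(ih n (by omega)).map fun b b' hb => by simpa using hb, ?_, ?_⟩
      · rw [List.nodup_flatMap]
        refine ⟨fun i hi => ?_, (List.nodup_range (n := n + 1)).imp fun {i i'} hii => ?_⟩
        · rw [List.mem_range] at hi
          exact nodup_block (ih i hi) (ih (n - i) (by omega))
        · rw [Function.onFun, List.disjoint_left]
          intro p hp hp'
          obtain ⟨a, ha, b, -, rfl⟩ := mem_block.1 hp
          obtain ⟨a', ha', b', -, hb'⟩ := mem_block.1 hp'
          rw [mem_pathList] at ha ha'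
          obtain ⟨rfl, -⟩ := ha.arch_inj ha' (List.cons.inj hb').2.symm
          exact hii (ha.unique ha')
      · rw [List.disjoint_left]
        intro p hp hp'
        obtain ⟨q, -, rfl⟩ := List.mem_map.1 hp
        obtain ⟨i, -, hi⟩ := List.mem_flatMap.1 hp'
        obtain ⟨a, -, b, -, hb⟩ := mem_block.1 hi
        simp at hb

theorem length_pathList (n : ℕ) : (pathList n).length = Nat.largeSchroder n := by
  induction n using Nat.strong_induction_on with
  | _ n ih =>
    cases n with
    | zero => simp [pathList]
    | succ n =>
      have hblock : ∀ i ∈ List.range (n + 1), (block n i).length =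
          Nat.largeSchroder i * Nat.largeSchroder (n - i) := by
        intro i hi
        rw [List.mem_range] at hi
        have : ∀ aj, (innerBlock n i aj).length = Nat.largeSchroder (n - i) := by
          intro aj
          rw [innerBlock, List.length_map, length_orient, ih _ (by omega)]
        rw [block, List.length_flatMap, funext this, List.map_const', List.sum_replicate,
          List.length_zipIdx, length_orient, ih i hi, smul_eq_mul]
      rw [pathList_succ, List.length_append, List.length_map, ih n (by omega),
        List.length_flatMap, List.map_congr_left hblock, Nat.largeSchroder]
      congr 1
      rw [Fin.sum_univ_eq_sum_range fun i => Nat.largeSchroder i * Nat.largeSchroder (n - i)]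
      rfl

/-! ### Ends of the blocks. -/

theorem head?_orient_pathList {n : ℕ} (h1 : (pathList n).head? = some (flatPath n))
    (h2 : (pathList n).getLast? = some (peakPath n)) (j : ℕ) :
    (orient j (pathList n)).head? = some (endPath j n) := by
  rw [orient, endPath]
  split_ifs
  · exact h1
  · rw [List.head?_reverse, h2]

/-- Reversal exchanges the ends: the last entry in one orientation is the first in the other, hence
`j + 1`. -/
theorem getLast?_orient_pathList {n : ℕ} (h1 : (pathList n).head? = some (flatPath n))
    (h2 : (pathList n).getLast? = some (peakPath n)) (j : ℕ) :
    (orient j (pathList n)).getLast? = some (endPath (j + 1) n) := by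
  rw [orient, endPath]
  split_ifs with h hsucc hsucc
  · exact absurd hsucc (by simpa [Nat.odd_add_one] using h)
  · exact h2
  · rw [List.getLast?_reverse, h1]
  · exact absurd (Nat.odd_add_one.2 h) hsucc

/-- The first and the last entry of `pathList n`. -/
def HasEnds (n : ℕ) : Prop :=
  (pathList n).head? = some (flatPath n) ∧ (pathList n).getLast? = some (peakPath n)

theorem head?_innerBlock {n i : ℕ} (h : HasEnds (n - i)) (aj : Path × ℕ) :
    (innerBlock n i aj).head? =
      some (Step.u :: (aj.1 ++ Step.d :: endPath (aj.2 + B (i + 1) + 1) (n - i))) := by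
  rw [innerBlock, List.head?_map, head?_orient_pathList h.1 h.2]
  rfl

theorem getLast?_innerBlock {n i : ℕ} (h : HasEnds (n - i)) (aj : Path × ℕ) :
    (innerBlock n i aj).getLast? =
      some (Step.u :: (aj.1 ++ Step.d :: endPath (aj.2 + B (i + 1) + 2) (n - i))) := by
  rw [innerBlock, List.getLast?_map, getLast?_orient_pathList h.1 h.2]
  rfl

theorem head?_block {n i : ℕ} (hi : HasEnds i) (h : HasEnds (n - i)) :
    (block n i).head? = some (Step.u :: (endPath (n + i + 2) i ++
      Step.d :: endPath (B (i + 1) + 2) (n - i))) := by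
  have h1 : ((orient ((n + 1) + (i + 1)) (pathList i)).zipIdx 1).head? =
      some (endPath (n + i + 2) i, 1) := by
    rw [List.head?_zipIdx, head?_orient_pathList hi.1 hi.2,
      show n + 1 + (i + 1) = n + i + 2 by omega]
    rfl
  rw [block, head?_flatMap_of_head? h1 (head?_innerBlock h _)]
  rw [show 1 + B (i + 1) + 1 = B (i + 1) + 2 by omega]

/-- The last `j` is `r_i`, and `B (i + 1) + r_i = B (i + 2)`; this makes the parity of the outer
part match the start of the next block. -/
theorem getLast?_block {n i : ℕ} (hi : HasEnds i) (h : HasEnds (n - i)) :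
    (block n i).getLast? = some (Step.u :: (endPath (n + i + 3) i ++
      Step.d :: endPath (B (i + 2) + 2) (n - i))) := by
  have h1 : ((orient ((n + 1) + (i + 1)) (pathList i)).zipIdx 1).getLast? =
      some (endPath (n + i + 3) i, Nat.largeSchroder i) := by
    rw [List.getLast?_zipIdx, getLast?_orient_pathList hi.1 hi.2, length_orient,
      length_pathList, show n + 1 + (i + 1) + 1 = n + i + 3 by omega]
    simp
  rw [block, getLast?_flatMap_of_getLast? h1 (getLast?_innerBlock h _), B_succ,
    Nat.add_comm (Nat.largeSchroder i)]

theorem hasEnds (n : ℕ) : HasEnds n := by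
  induction n using Nat.strong_induction_on with
  | _ n ih =>
    cases n with
    | zero => simp [HasEnds, pathList, flatPath, peakPath]
    | succ n =>
      refine ⟨?_, ?_⟩
      · rw [pathList_succ, List.head?_append, List.head?_map, (ih n (by omega)).1]
        rfl
      · have h0 : HasEnds (n - n) := ih _ (by omega)
        have hl : (List.range (n + 1)).getLast? = some n := by simp [List.range_succ]
        -- In the last block `i = n`: the outer part is empty and the inner index `2 * n + 3` is
        -- odd, which gives `u eⁿ d`.
        rw [pathList_succ, List.getLast?_append,
          getLast?_flatMap_of_getLast? hl (getLast?_block (ih n (by omega)) h0), Nat.sub_self,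
          endPath_zero, endPath, if_pos ⟨n + 1, by omega⟩]
        rfl

/-! ### Consecutive entries are close. -/

theorem isChain_innerBlock {n i : ℕ} (hi : i ≤ n) {aj : Path × ℕ} (ha : Decomposed i aj.1)
    (h : (pathList (n - i)).IsChain (Close (n - i))) :
    (innerBlock n i aj).IsChain (Close (n + 1)) := by
  rw [innerBlock, List.isChain_map]
  refine (isChain_orient (fun _ _ => Close.symm) h).imp_of_mem_imp ?_
  intro b b' hb hb' hbb
  rw [mem_orient, mem_pathList] at hb hb'
  have := hbb.arch_right ha hb hb'
  rwa [show i + (n - i) + 1 = n + 1 by omega] at this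

theorem isChain_block {n i : ℕ} (hi : i ≤ n) (h : (pathList i).IsChain (Close i))
    (h' : (pathList (n - i)).IsChain (Close (n - i))) :
    (block n i).IsChain (Close (n + 1)) := by
  have hdec : ∀ aj ∈ (orient ((n + 1) + (i + 1)) (pathList i)).zipIdx 1, Decomposed i aj.1 :=
    fun aj haj => mem_pathList.1 (mem_orient.1 (mem_of_mem_zipIdx haj))
  refine isChain_flatMap (fun aj _ he => ?_) (fun aj haj => isChain_innerBlock hi (hdec aj haj) h')
    ((isChain_zipIdx 1 (isChain_orient (fun _ _ => Close.symm) h)).imp_of_mem_imp ?_)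
  · have := head?_innerBlock (hasEnds (n - i)) aj
    rw [he] at this
    simp at this
  · rintro aj aj' haj haj' ⟨hc, hj⟩ x hx y hy
    rw [getLast?_innerBlock (hasEnds _), Option.mem_some_iff] at hx
    rw [head?_innerBlock (hasEnds _), Option.mem_some_iff, hj] at hy
    subst hx hy
    -- Raising `j` by one reverses the outer list, so its part is the same on both sides of the
    -- joint.
    have := hc.arch_left (hdec aj haj) (hdec aj' haj')
      (decomposed_endPath (aj.2 + B (i + 1) + 2) (n - i))
    rw [show i + (n - i) + 1 = n + 1 by omega] at this
    rwa [show aj.2 + 1 + B (i + 1) + 1 = aj.2 + B (i + 1) + 2 by omega]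

theorem isChain_pathList (n : ℕ) : (pathList n).IsChain (Close n) := by
  induction n using Nat.strong_induction_on with
  | _ n ih =>
    cases n with
    | zero => simp [pathList]
    | succ n =>
      rw [pathList_succ, List.isChain_append]
      refine ⟨?_, isChain_flatMap (fun i _ he => ?_) (fun i hi => ?_) ?_, ?_⟩
      · rw [List.isChain_map]
        refine (ih n (by omega)).imp_of_mem_imp ?_
        intro p q hp hq hpq
        exact hpq.level (mem_pathList.1 hp) (mem_pathList.1 hq)
      · have := head?_block (n := n) (hasEnds i) (hasEnds (n - i))
        rw [he] at this
        simp at this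
      · rw [List.mem_range] at hi
        exact isChain_block (by omega) (ih i hi) (ih (n - i) (by omega))
      · rw [List.isChain_iff_getElem]
        intro i hi x hx y hy
        rw [List.length_range] at hi
        rw [List.getElem_range] at hx hy
        rw [getLast?_block (hasEnds _) (hasEnds _), Option.mem_some_iff] at hx
        rw [head?_block (hasEnds _) (hasEnds _), Option.mem_some_iff] at hy
        subst hx hy
        obtain ⟨m, rfl⟩ : ∃ m, n = i + 1 + m := ⟨n - (i + 1), by omega⟩
        -- The parity indices of both parts agree on the two sides of the joint; only the
        -- semilengths change.
        have := close_endPath_succ (i + 1 + m + i + 3) (B (i + 2) + 2) i m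
        rw [show i + 1 + m + (i + 1) + 2 = i + 1 + m + i + 3 by omega,
          show i + 1 + m - i = m + 1 by omega, show i + 1 + m - (i + 1) = m by omega]
        rwa [show i + m + 2 = i + 1 + m + 1 by omega] at this
      · intro x hx y hy
        rw [List.getLast?_map, (hasEnds n).2, Option.map_some, Option.mem_some_iff] at hx
        have hl : (List.range (n + 1)).head? = some 0 := by simp [List.range_succ_eq_map]
        rw [head?_flatMap_of_head? hl (head?_block (hasEnds 0) (hasEnds (n - 0))),
          Option.mem_some_iff, endPath_zero] at hy
        subst hx hy
        -- As `B 1 = 0`, the first block starts from the path with which the level part ended.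
        have : endPath (B (0 + 1) + 2) (n - 0) = peakPath n := by
          simp [endPath, B, Nat.odd_iff]
        rw [this]
        exact close_level_arch (decomposed_peakPath n)

end SchroderGray

open SchroderGray

theorem mainTheorem3 (n : ℕ) :
    (SchroderGray.pathList n).length = Nat.largeSchroder n ∧
    SchroderGray.IsGrayCode SchroderGray.pathDist 5
      {p | SchroderGray.IsSchroderPath n p} (SchroderGray.pathList n) ∧
    Set.BijOn (SchroderGray.phi n)
      {p | SchroderGray.IsSchroderPath n p} (SchroderGray.schroderPerms (n + 1)) ∧
    SchroderGray.IsGrayCode SchroderGray.permDist 5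
      (SchroderGray.schroderPerms (n + 1)) (SchroderGray.permList n) := by
  have hmem : ∀ p, p ∈ pathList n ↔ p ∈ {p | IsSchroderPath n p} := fun p =>
    mem_pathList.trans isSchroderPath_iff_decomposed.symm
  have hbij := phi_bijOn n
  have hchain := List.isChain_iff_getElem.1 (isChain_pathList n)
  refine ⟨length_pathList n, ⟨nodup_pathList n, hmem, fun q hq => (hchain q hq).1⟩, hbij,
    ?_, fun π => ?_, fun q hq => ?_⟩
  · exact (nodup_pathList n).map_on fun p hp q hq h =>
      hbij.injOn ((hmem p).1 hp) ((hmem q).1 hq) h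
  · rw [permList, List.mem_map, ← hbij.image_eq]
    exact exists_congr fun p => and_congr (hmem p) Iff.rfl
  · simp only [permList, List.getElem_map]
    rw [permList, List.length_map] at hq
    exact (permDist_phi_le (mem_pathList.1 (List.getElem_mem _))
      (mem_pathList.1 (List.getElem_mem _))).trans (hchain q hq).2
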